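/- Let $p\ge 1$ and let $m$ be Lebesgue measure on $I=[0,1]$. For $f:I\to\mathbb C$ and $r>0$ put $\operatorname{osc}(f,r,x)=\sup\{|f(y_1)-f(y_2)| : y_1,y_2\in(x-r,x+r)\cap I\}$ and, for a constant $A>0$, $$\operatorname{var}(f)=\sup_{0<r\le A} r^{-1/p}\int_I \operatorname{osc}(f,r,x)\,dm(x);$$ for an $m$-equivalence class, $\operatorname{var}_{1,1/p}$ is the infimum of $\operatorname{var}$ over all versions. Let $BV_{1,1/p}$ be the space of classes $f\in L^1(I,m)$ with $\operatorname{var}_{1,1/p}(f)<\infty$, and let $\|f\|_{1,1/p}=\operatorname{var}_{1,1/p}(f)+\|f\|_1$ (both $\operatorname{var}_{1,1/p}$ and the norm depend on $A$). Let $0=a_0<a_1<\dots<a_q=1$, $I_i=(a_{i-1},a_i)$, and let $\tau:I\to I$ be such that for each $i$: $\tau|_{I_i}$ is monotonic, $C^1$, and extends to a $C^1$ function on $\overline{I_i}$; there is $M_i$ with $|\tau'(x)-\tau'(y)|\le M_i|x-y|^{1/p}$ for $x,y\in I_i$; and $|\tau'(x)|\ge s_i>1$ for $x\in I_i$. Put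 $s=\min_i s_i$ and let $$P_\tau f(x)=\sum_{i=1}^q \frac{f(\tau_i^{-1}(x))}{|\tau'(\tau_i^{-1}(x))|}\,\chi_{\tau(I_i)}(x),\qquad \tau_i=\tau|_{I_i},$$ be the Frobenius–Perron operator. Then: (1) For every $A>0$ there are $\alpha,\beta>0$ such that for every $f\in BV_{1,1/p}$ one has $P_\tau f\in BV_{1,1/p}$ and $\operatorname{var}_{1,1/p}(P_\tau f)\le\alpha\operatorname{var}_{1,1/p}(f)+\beta\|f\|_1$. (2) For every $\alpha>s^{-1/p}+s^{-1}$ there is $A_0>0$ such that for every $A\in(0,A_0]$ there is $\beta>0$ with $\operatorname{var}_{1,1/p}(P_\tau f)\le\alpha\operatorname{var}_{1,1/p}(f)+\beta\|f\|_1$ for all $f\in BV_{1,1/p}$. (3) (Lasota–Yorke inequality) If $s^{-1/p}+s^{-1}<1$, then there is $A_0>0$ such that for every $A\in(0,A_0]$ there are $0<\alpha<1$ and $K>0$ such that for every $f\in BV_{1,1/p}$ one has $P_\tau f\in BV_{1,1/p}$ and $$\|P_\tau f\|_{1,1/p}\le\alpha\|f\|_{1,1/p}+K\|f\|_1 .$$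 -/

import Mathlib

/-!
The Frobenius–Perron operator is a sum of branch transfers `z ↦ f (τᵢ⁻¹ z) / |τ' (τᵢ⁻¹ z)|`, each
extended by zero off `τ(Iᵢ)`. Inside `τ(Iᵢ)` the expansion `σ ≤ |τ'|` pulls a ball of radius `σρ`
back into a ball of radius `ρ`, so a change of variables bounds the oscillation of the branch at
scale `σρ` by that of `f` at scale `ρ`, up to a distortion factor that the Hölder condition on `τ'`
makes as close to `1` as desired at small scales. Since `ρ^{1/p} = σ^{-1/p} (σρ)^{1/p}`, this gives
the term `σ^{-1/p}`.

The jumps of the extension by zero contribute, at each endpoint of `Iᵢ`, the integral of `|f|` over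
an interval of length `2ρ`. For `p > 1`, comparing these values of `f` with their average over an
interval of length `A` costs a multiple of `ρ / A` times the oscillation at scale `A`, which is
negligible against `ρ^{1/p}` as `ρ → 0`. For `p = 1`, telescoping over half of `Iᵢ` with steps `2ρ`
costs the oscillation at scale `ρ` exactly once. In both cases the total extra factor is at most
`σ⁻¹`.
-/

open Set MeasureTheory
open scoped ENNReal

/-- Lebesgue measure on the unit interval `I = [0,1]`. Functions on `I` are written as functions on
`ℝ`; only their values on `I` are ever used. -/
noncomputable def lebI : Measure ℝ := volume.restrict (Icc (0 : ℝ) 1)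

/-- The relative ball `S_r(x) = (x - r, x + r) ∩ I`. -/
def relBall (r x : ℝ) : Set ℝ := Ioo (x - r) (x + r) ∩ Icc 0 1

/-- The oscillation `osc(f, r, x) = sup_{y₁, y₂ ∈ S_r(x)} |f y₁ - f y₂|`. -/
noncomputable def osc (f : ℝ → ℂ) (r x : ℝ) : ℝ≥0∞ :=
  ⨆ y₁ ∈ relBall r x, ⨆ y₂ ∈ relBall r x, ‖f y₁ - f y₂‖ₑ

/-- `osc₁(f, r) = ∫_I osc(f, r, x) dx`. -/
noncomputable def oscOne (f : ℝ → ℂ) (r : ℝ) : ℝ≥0∞ := ∫⁻ x, osc f r x ∂lebI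

/-- The variation of an everywhere defined function,
`sup_{0 < r ≤ A} osc₁(f, r) / r^{1/p}`. -/
noncomputable def varFun (A p : ℝ) (f : ℝ → ℂ) : ℝ≥0∞ :=
  ⨆ r ∈ Ioc (0 : ℝ) A, oscOne f r / ENNReal.ofReal (r ^ (1 / p))

/-- `var_{1,1/p}` of the `m`-equivalence class of `f`: the least variation of a version of `f`. -/
noncomputable def varClass (A p : ℝ) (f : ℝ → ℂ) : ℝ≥0∞ :=
  ⨅ (g : ℝ → ℂ) (_ : g =ᵐ[lebI] f), varFun A p g

/-- The class of `f` lies in `BV_{1,1/p}`: `f` is in `L¹(I)` and has a version of finite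
variation. -/
def MemBV (A p : ℝ) (f : ℝ → ℂ) : Prop :=
  MemLp f 1 lebI ∧ varClass A p f < ∞

/-- The norm of `BV_{1,1/p}`: the variation plus the `L¹` norm. -/
noncomputable def bvNorm (A p : ℝ) (f : ℝ → ℂ) : ℝ≥0∞ :=
  varClass A p f + eLpNorm f 1 lebI

/-- The `i`-th open interval `(a_i, a_{i+1})` of a partition `a_0 < a_1 < ⋯ < a_q`. -/
def piece {q : ℕ} (a : Fin (q + 1) → ℝ) (i : Fin q) : Set ℝ := Ioo (a i.castSucc) (a i.succ)

/-- `τ` is a piecewise expanding, piecewise `C^{1+ε}` map of `I = [0,1]` for the partition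
`0 = a_0 < a_1 < ⋯ < a_q = 1` with lower slope bounds `s_i > 1`. -/
structure IsPiecewiseExpanding (ε : ℝ) (τ : ℝ → ℝ) {q : ℕ} (a : Fin (q + 1) → ℝ)
    (s : Fin q → ℝ) : Prop where
  mapsTo : MapsTo τ (Icc 0 1) (Icc 0 1)
  strictMono : StrictMono a
  first : a 0 = 0
  last : a (Fin.last q) = 1
  monotone : ∀ i, MonotoneOn τ (piece a i) ∨ AntitoneOn τ (piece a i)
  extend : ∀ i, ∃ T : ℝ → ℝ, EqOn T τ (piece a i) ∧
    ContDiffOn ℝ 1 T (Icc (a i.castSucc) (a i.succ))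
  holder : ∀ i, ∃ M : ℝ, ∀ x ∈ piece a i, ∀ y ∈ piece a i,
    |deriv τ x - deriv τ y| ≤ M * |x - y| ^ ε
  one_lt : ∀ i, 1 < s i
  slope : ∀ i, ∀ x ∈ piece a i, s i ≤ |deriv τ x|

/-- The Frobenius–Perron operator: `P_τ f (x)` is the sum, over the branches `i` whose image
`τ(I_i)` contains `x`, of `f y / |τ' y|`, where `y` is the point of `I_i` with `τ y = x`. -/
noncomputable def frobeniusPerron (τ : ℝ → ℝ) {q : ℕ} (a : Fin (q + 1) → ℝ) (f : ℝ → ℂ) :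
    ℝ → ℂ := fun x =>
  ∑ i : Fin q, (τ '' piece a i).indicator
    (fun z => f (Function.invFunOn τ (piece a i) z) /
      ((|deriv τ (Function.invFunOn τ (piece a i) z)| : ℝ) : ℂ)) x

section Oscillation

variable {X Y : Type*} [PseudoMetricSpace X] [PseudoEMetricSpace Y] {f : X → Y} {U V K : Set X}
  {r r' : ℝ} {x y₁ y₂ : X} {C : ℝ≥0∞}

/-- The oscillation of `f` at scale `r` around `x` when only the points of `U` are seen. It is `osc`
for `U = Icc 0 1`; the oscillations of single branches use subintervals of it or the whole line. -/
noncomputable def oscWithin (f : X → Y) (U : Set X) (r : ℝ) (x : X) : ℝ≥0∞ :=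
  Metric.ediam (f '' (Metric.ball x r ∩ U))

theorem edist_le_oscWithin (h₁ : y₁ ∈ Metric.ball x r ∩ U) (h₂ : y₂ ∈ Metric.ball x r ∩ U) :
    edist (f y₁) (f y₂) ≤ oscWithin f U r x :=
  Metric.edist_le_ediam_of_mem (mem_image_of_mem f h₁) (mem_image_of_mem f h₂)

theorem ediam_image_le_oscWithin (hK : K ⊆ Metric.ball x r ∩ U) :
    Metric.ediam (f '' K) ≤ oscWithin f U r x :=
  Metric.ediam_mono (image_mono hK)

theorem oscWithin_mono (hUV : U ⊆ V) (hr : r ≤ r') : oscWithin f U r x ≤ oscWithin f V r' x :=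
  ediam_image_le_oscWithin (inter_subset_inter (Metric.ball_subset_ball hr) hUV)

theorem oscWithin_comp_isometryEquiv {Z : Type*} [PseudoMetricSpace Z] (e : Z ≃ᵢ X) (z : Z) :
    oscWithin (f ∘ e) (e ⁻¹' U) r z = oscWithin f U r (e z) := by
  rw [oscWithin, oscWithin, image_comp, image_inter_preimage, e.image_ball]

theorem oscWithin_sum_le {ι E : Type*} [NormedAddCommGroup E] (s : Finset ι) (f : ι → X → E)
    (U : Set X) (r : ℝ) (x : X) :
    oscWithin (∑ i ∈ s, f i) U r x ≤ ∑ i ∈ s, oscWithin (f i) U r x := by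
  refine Metric.ediam_image_le_iff.2 fun y₁ h₁ y₂ h₂ => ?_
  rw [Finset.sum_apply, Finset.sum_apply, edist_eq_enorm_sub, ← Finset.sum_sub_distrib]
  refine (enorm_sum_le _ _).trans (Finset.sum_le_sum fun i _ => ?_)
  rw [← edist_eq_enorm_sub]
  exact edist_le_oscWithin h₁ h₂

theorem lowerSemicontinuous_oscWithin (f : X → Y) (U : Set X) (r : ℝ) :
    LowerSemicontinuous (oscWithin f U r) := by
  intro x b hb
  obtain ⟨y₁, ⟨h₁, hU₁⟩, y₂, ⟨h₂, hU₂⟩, hlt⟩ :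
      ∃ y₁ ∈ Metric.ball x r ∩ U, ∃ y₂ ∈ Metric.ball x r ∩ U, b < edist (f y₁) (f y₂) := by
    contrapose! hb
    exact Metric.ediam_image_le_iff.2 hb
  filter_upwards [Metric.isOpen_ball.mem_nhds (Metric.mem_ball_comm.1 h₁),
    Metric.isOpen_ball.mem_nhds (Metric.mem_ball_comm.1 h₂)] with w hw₁ hw₂
  exact hlt.trans_le (edist_le_oscWithin ⟨Metric.mem_ball_comm.1 hw₁, hU₁⟩
    ⟨Metric.mem_ball_comm.1 hw₂, hU₂⟩)

variable [MeasurableSpace X] {μ : Measure X}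

@[fun_prop]
theorem measurable_oscWithin [OpensMeasurableSpace X] (f : X → Y) (U : Set X) (r : ℝ) :
    Measurable (oscWithin f U r) :=
  (lowerSemicontinuous_oscWithin f U r).measurable

theorem lintegral_oscWithin_le_of_forall_lt [OpensMeasurableSpace X] (hr : 0 < r)
    (h : ∀ r' ∈ Ioo 0 r, ∫⁻ x, oscWithin f U r' x ∂μ ≤ C) :
    ∫⁻ x, oscWithin f U r x ∂μ ≤ C := by
  obtain ⟨u, hu_mono, hu_mem, hu_lim⟩ := exists_seq_strictMono_tendsto' hr
  have hle (x : X) : oscWithin f U r x ≤ ⨆ n, oscWithin f U (u n) x := by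
    refine Metric.ediam_image_le_iff.2 fun y₁ h₁ y₂ h₂ => ?_
    obtain ⟨n, hn₁, hn₂⟩ :=
      ((hu_lim.eventually_const_lt h₁.1).and (hu_lim.eventually_const_lt h₂.1)).exists
    exact (edist_le_oscWithin ⟨hn₁, h₁.2⟩ ⟨hn₂, h₂.2⟩).trans
      (le_iSup (fun n => oscWithin f U (u n) x) n)
  calc ∫⁻ x, oscWithin f U r x ∂μ
      ≤ ∫⁻ x, ⨆ n, oscWithin f U (u n) x ∂μ := lintegral_mono hle
    _ = ⨆ n, ∫⁻ x, oscWithin f U (u n) x ∂μ :=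
        lintegral_iSup (fun n => measurable_oscWithin f U (u n)) fun _ _ hmn x =>
          oscWithin_mono Subset.rfl (hu_mono.monotone hmn)
    _ ≤ C := iSup_le fun n => h (u n) (hu_mem n)

theorem measure_mul_ediam_image_le {S : Set X} (hS : MeasurableSet S)
    (hK : ∀ x ∈ S, K ⊆ Metric.ball x r ∩ U) :
    μ S * Metric.ediam (f '' K) ≤ ∫⁻ x in S, oscWithin f U r x ∂μ := by
  rw [mul_comm, ← setLIntegral_const]
  exact setLIntegral_mono' hS fun x hx => ediam_image_le_oscWithin (hK x hx)

end Oscillation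

theorem measure_mul_enorm_le {X E : Type*} [MeasurableSpace X] {μ : Measure X}
    [NormedAddCommGroup E] {g : X → E} {S K : Set X} (hS : MeasurableSet S) (hSK : S ⊆ K) {t : X}
    (ht : t ∈ K) :
    μ S * ‖g t‖ₑ ≤ ∫⁻ x in S, ‖g x‖ₑ ∂μ + μ S * Metric.ediam (g '' K) := by
  rw [mul_comm, mul_comm (μ S), ← setLIntegral_const, ← setLIntegral_const,
    ← lintegral_add_right _ measurable_const]
  refine setLIntegral_mono' hS fun x hx => ?_
  calc ‖g t‖ₑ = ‖g x + (g t - g x)‖ₑ := by rw [add_sub_cancel]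
    _ ≤ ‖g x‖ₑ + ‖g t - g x‖ₑ := enorm_add_le _ _
    _ ≤ ‖g x‖ₑ + Metric.ediam (g '' K) := by
      rw [← edist_eq_enorm_sub]
      gcongr
      exact Metric.edist_le_ediam_of_mem (mem_image_of_mem g ht) (mem_image_of_mem g (hSK hx))

section RealLineIntegrals

theorem setLIntegral_Ioo_comp_add_right (G : ℝ → ℝ≥0∞) (x y c : ℝ) :
    ∫⁻ t in Ioo x y, G (t + c) = ∫⁻ t in Ioo (x + c) (y + c), G t := by
  rw [(measurePreserving_add_right volume c).setLIntegral_comp_emb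
    (measurableEmbedding_addRight c) G (Ioo x y), image_add_const_Ioo]

theorem setLIntegral_comp_neg (G : ℝ → ℝ≥0∞) (S : Set ℝ) :
    ∫⁻ t in S, G (-t) = ∫⁻ t in -S, G t := by
  rw [(Measure.measurePreserving_neg volume).setLIntegral_comp_emb
    (MeasurableEquiv.neg ℝ).measurableEmbedding G S, image_neg_eq_neg]

theorem oscWithin_comp_neg {Y : Type*} [PseudoEMetricSpace Y] (f : ℝ → Y) (U : Set ℝ) (r x : ℝ) :
    oscWithin (fun t => f (-t)) U r x = oscWithin f (-U) r (-x) := by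
  conv_lhs => rw [← neg_neg U]
  exact oscWithin_comp_isometryEquiv (IsometryEquiv.neg ℝ) x

theorem image_comp_neg {Y : Type*} (f : ℝ → Y) (S : Set ℝ) :
    (fun t => f (-t)) '' S = f '' (-S) := by
  rw [← image_neg_eq_neg, image_image]

theorem setLIntegral_Ioo_add_setLIntegral_Ioo (G : ℝ → ℝ≥0∞) {x y z : ℝ} (hxy : x ≤ y)
    (hyz : y ≤ z) :
    (∫⁻ t in Ioo x y, G t) + ∫⁻ t in Ioo y z, G t = ∫⁻ t in Ioo x z, G t := by
  simp only [restrict_Ioo_eq_restrict_Ioc]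
  rw [← Ioc_union_Ioc_eq_Ioc hxy hyz,
    lintegral_union measurableSet_Ioc (Ioc_disjoint_Ioc_of_le le_rfl)]

theorem sum_setLIntegral_Ioo (G : ℝ → ℝ≥0∞) (u : ℝ) {d : ℝ} (hd : 0 ≤ d) (N : ℕ) :
    ∑ n ∈ Finset.range N, ∫⁻ t in Ioo (u + d * n) (u + d * (n + 1)), G t =
      ∫⁻ t in Ioo u (u + d * N), G t := by
  induction N with
  | zero => simp
  | succ N ih =>
    rw [Finset.sum_range_succ, ih, Nat.cast_succ]
    exact setLIntegral_Ioo_add_setLIntegral_Ioo G (le_add_of_nonneg_right (by positivity))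
      (by gcongr; exact le_add_of_nonneg_right zero_le_one)

end RealLineIntegrals

section ExtensionByZero

variable {E : Type*} [NormedAddCommGroup E]

theorem ediam_image_le_add_enorm {X : Type*} {h : X → E} {J U V : Set X} {z : X}
    (h0 : ∀ x ∉ J, h x = 0) (hUV : U ∩ J ⊆ V) (hz : z ∈ V) :
    Metric.ediam (h '' U) ≤ Metric.ediam (h '' V) + ‖h z‖ₑ := by
  have hedist {y y' : X} (hy : y ∈ V) (hy' : y' ∈ V) :
      edist (h y) (h y') ≤ Metric.ediam (h '' V) :=
    Metric.edist_le_ediam_of_mem (mem_image_of_mem h hy) (mem_image_of_mem h hy')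
  have henorm {y : X} (hy : y ∈ V) : ‖h y‖ₑ ≤ Metric.ediam (h '' V) + ‖h z‖ₑ := by
    rw [← edist_zero_right, ← edist_zero_right]
    exact (edist_triangle _ (h z) _).trans (by gcongr; exact hedist hy hz)
  refine Metric.ediam_image_le_iff.2 fun y₁ h₁ y₂ h₂ => ?_
  by_cases hJ₁ : y₁ ∈ J <;> by_cases hJ₂ : y₂ ∈ J
  · exact (hedist (hUV ⟨h₁, hJ₁⟩) (hUV ⟨h₂, hJ₂⟩)).trans le_self_add
  · rw [h0 y₂ hJ₂, edist_zero_right]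
    exact henorm (hUV ⟨h₁, hJ₁⟩)
  · rw [h0 y₁ hJ₁, edist_zero_left]
    exact henorm (hUV ⟨h₂, hJ₂⟩)
  · simp [h0 y₁ hJ₁, h0 y₂ hJ₂]

variable {h : ℝ → E} {c d m r r' : ℝ}

theorem oscWithin_univ_eq_zero {x : ℝ} (h0 : ∀ x ∉ Ioo c d, h x = 0) (hx : x + r ≤ c) :
    oscWithin h univ r x = 0 := by
  have hball (y : ℝ) (hy : y ∈ Metric.ball x r ∩ univ) : h y = 0 := by
    rw [inter_univ, Real.ball_eq_Ioo] at hy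
    exact h0 y fun hcd => by linarith [hy.2, hcd.1]
  refine le_antisymm (Metric.ediam_image_le_iff.2 fun y₁ h₁ y₂ h₂ => ?_) zero_le
  simp [hball y₁ h₁, hball y₂ h₂]

/- The zero values of `h` are compared with `h (x + r)`: as `x` runs through `(c - r, c + r)` this
point sweeps `(c, c + 2r)` exactly once, which is what keeps the constants sharp. -/
theorem setLIntegral_Ioo_sub_left_oscWithin_univ_le (h0 : ∀ x ∉ Ioo c d, h x = 0) (hrr' : r < r') :
    ∫⁻ x in Ioo (c - r) c, oscWithin h univ r x ≤
      ENNReal.ofReal r * Metric.ediam (h '' Ioo c (c + r')) +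
        ∫⁻ x in Ioo c (c + r), ‖h x‖ₑ := by
  have hpt (x : ℝ) (hx : x ∈ Ioo (c - r) c) :
      oscWithin h univ r x ≤ Metric.ediam (h '' Ioo c (c + r')) + ‖h (x + r)‖ₑ := by
    refine ediam_image_le_add_enorm h0 (fun y hy => ?_) ⟨?_, ?_⟩
    · simp only [inter_univ, Real.ball_eq_Ioo] at hy
      exact ⟨hy.2.1, by linarith [hy.1.2, hx.2]⟩
    all_goals linarith [hx.1, hx.2]
  refine (setLIntegral_mono' measurableSet_Ioo hpt).trans_eq ?_
  rw [lintegral_add_left measurable_const, setLIntegral_const, Real.volume_Ioo,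
    setLIntegral_Ioo_comp_add_right (fun x => ‖h x‖ₑ), sub_add_cancel, sub_sub_cancel, mul_comm]

theorem setLIntegral_Ioo_left_add_oscWithin_univ_le (h0 : ∀ x ∉ Ioo c d, h x = 0)
    (hr : 0 < r) (hrr' : r < r') (hd : c + 2 * r ≤ d) :
    ∫⁻ x in Ioo c (c + r), oscWithin h univ r x ≤
      (∫⁻ x in Ioo c (c + r), oscWithin h (Ioo c d) r' x) +
        ∫⁻ x in Ioo (c + r) (c + 2 * r), ‖h x‖ₑ := by
  have hpt (x : ℝ) (hx : x ∈ Ioo c (c + r)) :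
      oscWithin h univ r x ≤ oscWithin h (Ioo c d) r' x + ‖h (x + r)‖ₑ := by
    refine ediam_image_le_add_enorm h0 ?_ ⟨?_, ?_, ?_⟩
    · rw [inter_univ]
      exact inter_subset_inter_left _ (Metric.ball_subset_ball hrr'.le)
    · rw [Real.ball_eq_Ioo]
      constructor <;> linarith
    all_goals linarith [hx.1, hx.2]
  refine (setLIntegral_mono' measurableSet_Ioo hpt).trans_eq ?_
  rw [lintegral_add_left (by fun_prop), setLIntegral_Ioo_comp_add_right (fun x => ‖h x‖ₑ),
    add_assoc, ← two_mul]

theorem lintegral_Iio_oscWithin_univ_le (h0 : ∀ x ∉ Ioo c d, h x = 0) (hr : 0 < r)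
    (hrr' : r < r') (hm : c + r ≤ m) (hd : m + r ≤ d) :
    ∫⁻ x in Iio m, oscWithin h univ r x ≤ (∫⁻ x in Ioo c m, oscWithin h (Ioo c d) r' x) +
      (ENNReal.ofReal r * Metric.ediam (h '' Ioo c (c + r')) +
        ∫⁻ x in Ioo c (c + 2 * r), ‖h x‖ₑ) := by
  have hcover : Iio m ⊆ Iic (c - r) ∪ Ioo (c - r) m := fun x hx =>
    (le_or_gt x (c - r)).imp id fun hlt => ⟨hlt, hx⟩
  have hfar : ∫⁻ x in Iic (c - r), oscWithin h univ r x = 0 :=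
    setLIntegral_eq_zero measurableSet_Iic fun x hx =>
      oscWithin_univ_eq_zero h0 (le_sub_iff_add_le.1 hx)
  have hbulk : ∫⁻ x in Ioo (c + r) m, oscWithin h univ r x ≤
      ∫⁻ x in Ioo (c + r) m, oscWithin h (Ioo c d) r' x := by
    refine setLIntegral_mono' measurableSet_Ioo fun x hx => ediam_image_le_oscWithin ?_
    rw [inter_univ]
    refine subset_inter (Metric.ball_subset_ball hrr'.le) ?_
    rw [Real.ball_eq_Ioo]
    exact Ioo_subset_Ioo (by linarith [hx.1]) (by linarith [hx.2])
  calc ∫⁻ x in Iio m, oscWithin h univ r x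
      ≤ ∫⁻ x in Ioo (c - r) m, oscWithin h univ r x := by
        grw [hcover, lintegral_union_le, hfar, zero_add]
    _ = (∫⁻ x in Ioo (c - r) c, oscWithin h univ r x) +
        ((∫⁻ x in Ioo c (c + r), oscWithin h univ r x) +
          ∫⁻ x in Ioo (c + r) m, oscWithin h univ r x) := by
        rw [setLIntegral_Ioo_add_setLIntegral_Ioo _ (by linarith) hm,
          setLIntegral_Ioo_add_setLIntegral_Ioo _ (by linarith) (by linarith)]
    _ ≤ (ENNReal.ofReal r * Metric.ediam (h '' Ioo c (c + r')) + ∫⁻ x in Ioo c (c + r), ‖h x‖ₑ) +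
        (((∫⁻ x in Ioo c (c + r), oscWithin h (Ioo c d) r' x) +
          ∫⁻ x in Ioo (c + r) (c + 2 * r), ‖h x‖ₑ) +
          ∫⁻ x in Ioo (c + r) m, oscWithin h (Ioo c d) r' x) := by
        gcongr
        · exact setLIntegral_Ioo_sub_left_oscWithin_univ_le h0 hrr'
        · exact setLIntegral_Ioo_left_add_oscWithin_univ_le h0 hr hrr' (by linarith)
    _ = _ := by
        rw [← setLIntegral_Ioo_add_setLIntegral_Ioo _ (by linarith : c ≤ c + r) hm,
          ← setLIntegral_Ioo_add_setLIntegral_Ioo _ (by linarith : c ≤ c + r)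
            (by linarith : c + r ≤ c + 2 * r)]
        ring

theorem lintegral_Ioi_oscWithin_univ_le (h0 : ∀ x ∉ Ioo c d, h x = 0) (hr : 0 < r)
    (hrr' : r < r') (hm : m + r ≤ d) (hc : c + r ≤ m) :
    ∫⁻ x in Ioi m, oscWithin h univ r x ≤ (∫⁻ x in Ioo m d, oscWithin h (Ioo c d) r' x) +
      (ENNReal.ofReal r * Metric.ediam (h '' Ioo (d - r') d) +
        ∫⁻ x in Ioo (d - 2 * r) d, ‖h x‖ₑ) := by
  have h0' (x : ℝ) (hx : x ∉ Ioo (-d) (-c)) : h (-x) = 0 :=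
    h0 _ (by rwa [← neg_Ioo, mem_neg] at hx)
  have := lintegral_Iio_oscWithin_univ_le (m := -m) h0' hr hrr' (by linarith) (by linarith)
  have hsub (δ : ℝ) : -(-d + δ) = d - δ := by ring
  simpa only [oscWithin_comp_neg, setLIntegral_comp_neg (oscWithin h _ _),
    setLIntegral_comp_neg (fun x => ‖h x‖ₑ), image_comp_neg, neg_univ, neg_Ioo, neg_Iio, neg_neg,
    hsub] using this

theorem lintegral_oscWithin_univ_le (h0 : ∀ x ∉ Ioo c d, h x = 0) (hr : 0 < r)
    (hrr' : r < r') (hcd : c + 2 * r ≤ d) :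
    ∫⁻ x, oscWithin h univ r x ≤ (∫⁻ x in Ioo c d, oscWithin h (Ioo c d) r' x) +
      ((ENNReal.ofReal r * Metric.ediam (h '' Ioo c (c + r')) +
        ∫⁻ x in Ioo c (c + 2 * r), ‖h x‖ₑ) +
      (ENNReal.ofReal r * Metric.ediam (h '' Ioo (d - r') d) +
        ∫⁻ x in Ioo (d - 2 * r) d, ‖h x‖ₑ)) := by
  have hleft : c + r ≤ (c + d) / 2 := by linarith
  have hright : (c + d) / 2 + r ≤ d := by linarith
  rw [← lintegral_add_compl _ (measurableSet_Iio (a := (c + d) / 2)), compl_Iio,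
    setLIntegral_congr Ioi_ae_eq_Ici.symm]
  grw [lintegral_Iio_oscWithin_univ_le h0 hr hrr' hleft hright,
    lintegral_Ioi_oscWithin_univ_le h0 hr hrr' hright hleft]
  rw [← setLIntegral_Ioo_add_setLIntegral_Ioo _ (by linarith : c ≤ (c + d) / 2)
    (by linarith : (c + d) / 2 ≤ d), add_add_add_comm]

end ExtensionByZero

section EndpointBound

variable {E : Type*} [NormedAddCommGroup E] {F : ℝ → E} {A B L ℓ ρ ρ₁ θ₁ θ₂ u v x : ℝ}

/-- Control of the boundary terms which the extension by zero of a branch creates at an endpoint `u`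
of an interval `(u, v)` of length at least `2ℓ`. Only integrals over the half of `(u, v)` next to
`u` are used, so that the bounds for the two endpoints can be added. -/
def EndpointBound (E : Type*) [NormedAddCommGroup E] (ℓ ρ A θ₁ θ₂ B : ℝ) : Prop :=
  ∀ ρ₁ ∈ Ioo 0 ρ, ∀ (F : ℝ → E) (u v : ℝ), 2 * ℓ ≤ v - u →
    ENNReal.ofReal ρ₁ * Metric.ediam (F '' Ioo u (u + ρ)) +
        ∫⁻ t in Ioo u (u + 2 * ρ₁), ‖F t‖ₑ ≤
      ENNReal.ofReal θ₁ * (∫⁻ t in Ioo u ((u + v) / 2), oscWithin F (Ioo u v) ρ t) +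
        ENNReal.ofReal θ₂ * (∫⁻ t in Ioo u ((u + v) / 2), oscWithin F (Ioo u v) A t) +
        ENNReal.ofReal B * ∫⁻ t in Ioo u ((u + v) / 2), ‖F t‖ₑ

theorem EndpointBound.add_le (h : EndpointBound E ℓ ρ A θ₁ θ₂ B) (hℓ : 0 ≤ ℓ) (hρ₁ : ρ₁ ∈ Ioo 0 ρ)
    (F : ℝ → E) (huv : 2 * ℓ ≤ v - u) :
    (ENNReal.ofReal ρ₁ * Metric.ediam (F '' Ioo u (u + ρ)) +
        ∫⁻ t in Ioo u (u + 2 * ρ₁), ‖F t‖ₑ) +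
      (ENNReal.ofReal ρ₁ * Metric.ediam (F '' Ioo (v - ρ) v) +
        ∫⁻ t in Ioo (v - 2 * ρ₁) v, ‖F t‖ₑ) ≤
      ENNReal.ofReal θ₁ * (∫⁻ t in Ioo u v, oscWithin F (Ioo u v) ρ t) +
        ENNReal.ofReal θ₂ * (∫⁻ t in Ioo u v, oscWithin F (Ioo u v) A t) +
        ENNReal.ofReal B * ∫⁻ t in Ioo u v, ‖F t‖ₑ := by
  have hleft := h ρ₁ hρ₁ F u v huv
  have hright := h ρ₁ hρ₁ (fun t => F (-t)) (-v) (-u) (by linarith)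
  have hmid : -((-v + -u) / 2) = (u + v) / 2 := by ring
  have hsub (δ : ℝ) : -(-v + δ) = v - δ := by ring
  simp only [oscWithin_comp_neg, setLIntegral_comp_neg (oscWithin F _ _),
    setLIntegral_comp_neg (fun t => ‖F t‖ₑ), image_comp_neg, neg_Ioo, neg_neg, hsub, hmid] at hright
  refine (add_le_add hleft hright).trans_eq ?_
  have hsplit (G : ℝ → ℝ≥0∞) := setLIntegral_Ioo_add_setLIntegral_Ioo G
    (by linarith : u ≤ (u + v) / 2) (by linarith : (u + v) / 2 ≤ v)
  rw [← hsplit, ← hsplit, ← hsplit]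
  ring

theorem ofReal_mul_ediam_image_Ioo_le (hx : x ≤ L) (hL : u + L ≤ v) :
    ENNReal.ofReal x * Metric.ediam (F '' Ioo u (u + L)) ≤
      ∫⁻ t in Ioo u (u + x), oscWithin F (Ioo u v) L t := by
  have h := measure_mul_ediam_image_le (μ := volume) (f := F) (K := Ioo u (u + L)) (U := Ioo u v)
    (r := L) (measurableSet_Ioo (a := u) (b := u + x)) fun t ht => by
      rw [Real.ball_eq_Ioo]
      exact subset_inter (Ioo_subset_Ioo (by linarith [ht.2]) (by linarith [ht.1]))
        (Ioo_subset_Ioo_right hL)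
  rwa [Real.volume_Ioo, add_sub_cancel_left] at h

theorem ofReal_mul_ediam_image_Ioo_le_half (hA : 0 < A) (hx : x ≤ ρ) (hρ : ρ ≤ A)
    (hAm : u + A ≤ (u + v) / 2) :
    ENNReal.ofReal x * Metric.ediam (F '' Ioo u (u + ρ)) ≤
      ENNReal.ofReal (ρ / A) * ∫⁻ t in Ioo u ((u + v) / 2), oscWithin F (Ioo u v) A t :=
  calc ENNReal.ofReal x * Metric.ediam (F '' Ioo u (u + ρ))
      ≤ ENNReal.ofReal ρ * Metric.ediam (F '' Ioo u (u + A)) := by gcongr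
    _ = ENNReal.ofReal (ρ / A) * (ENNReal.ofReal A * Metric.ediam (F '' Ioo u (u + A))) := by
        rw [← mul_assoc, ← ENNReal.ofReal_mul' hA.le, div_mul_cancel₀ _ hA.ne']
    _ ≤ ENNReal.ofReal (ρ / A) * ∫⁻ t in Ioo u (u + A), oscWithin F (Ioo u v) A t := by
        grw [ofReal_mul_ediam_image_Ioo_le (v := v) le_rfl (by linarith)]
    _ ≤ ENNReal.ofReal (ρ / A) * ∫⁻ t in Ioo u ((u + v) / 2), oscWithin F (Ioo u v) A t := by
        gcongr

theorem setLIntegral_Ioo_enorm_le (hL : 0 < L) (hx : x ≤ L) :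
    ∫⁻ t in Ioo u (u + x), ‖F t‖ₑ ≤ ENNReal.ofReal (x / L) *
      ((∫⁻ t in Ioo u (u + L), ‖F t‖ₑ) + ENNReal.ofReal L * Metric.ediam (F '' Ioo u (u + L))) := by
  have hpt (t : ℝ) (ht : t ∈ Ioo u (u + x)) : ‖F t‖ₑ ≤
      ((∫⁻ t in Ioo u (u + L), ‖F t‖ₑ) + ENNReal.ofReal L * Metric.ediam (F '' Ioo u (u + L))) /
        ENNReal.ofReal L := by
    have h := measure_mul_enorm_le (μ := volume) (g := F) measurableSet_Ioo Subset.rfl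
      (Ioo_subset_Ioo_right (add_le_add_right hx u) ht)
    rw [Real.volume_Ioo, add_sub_cancel_left] at h
    exact ENNReal.le_div_iff_mul_le (by simp [hL]) (by simp) |>.2 (mul_comm _ ‖F t‖ₑ ▸ h)
  refine (setLIntegral_mono' (μ := volume) measurableSet_Ioo hpt).trans_eq ?_
  rw [setLIntegral_const, Real.volume_Ioo, add_sub_cancel_left, ENNReal.ofReal_div_of_pos hL,
    ENNReal.div_eq_inv_mul, ENNReal.div_eq_inv_mul]
  ring

theorem endpointBound_of_le (hρ : ρ ≤ A) (hA : 0 < A) (hAℓ : A ≤ ℓ) (hρℓ : 2 * ρ ≤ ℓ) :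
    EndpointBound E ℓ ρ A 0 (ρ / A) 1 := by
  intro ρ₁ hρ₁ F u v huv
  rw [ENNReal.ofReal_zero, zero_mul, zero_add, ENNReal.ofReal_one, one_mul]
  refine add_le_add (ofReal_mul_ediam_image_Ioo_le_half hA hρ₁.2.le hρ (by linarith))
    (lintegral_mono_set (Ioo_subset_Ioo_right ?_))
  linarith [hρ₁.2]

theorem endpointBound_of_two_mul_le (hρ : 0 < ρ) (hρA : 2 * ρ ≤ A) (hAℓ : A ≤ ℓ) :
    EndpointBound E ℓ ρ A 0 (3 * ρ / A) (2 * ρ / A) := by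
  intro ρ₁ hρ₁ F u v huv
  have hA : 0 < A := by linarith
  set O := ∫⁻ t in Ioo u ((u + v) / 2), oscWithin F (Ioo u v) A t
  set N := ∫⁻ t in Ioo u ((u + v) / 2), ‖F t‖ₑ
  have hdiam : ENNReal.ofReal ρ₁ * Metric.ediam (F '' Ioo u (u + ρ)) ≤ ENNReal.ofReal (ρ / A) * O :=
    ofReal_mul_ediam_image_Ioo_le_half hA hρ₁.2.le (by linarith) (by linarith)
  have hdiamA : ENNReal.ofReal A * Metric.ediam (F '' Ioo u (u + A)) ≤ O := by
    simpa [hA.ne'] using ofReal_mul_ediam_image_Ioo_le_half (F := F) (v := v) hA le_rfl le_rfl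
      (by linarith)
  have hmass : ∫⁻ t in Ioo u (u + 2 * ρ₁), ‖F t‖ₑ ≤ ENNReal.ofReal (2 * ρ / A) * (N + O) := by
    grw [hρ₁.2, setLIntegral_Ioo_enorm_le hA hρA, hdiamA,
      (by linarith : u + A ≤ (u + v) / 2)]
  grw [hdiam, hmass]
  rw [ENNReal.ofReal_zero, zero_mul, zero_add, mul_add, add_comm (_ * N), ← add_assoc, ← add_mul,
    ← ENNReal.ofReal_add (by positivity) (by positivity)]
  gcongr
  exact le_of_eq (by ring)

/- Telescoping along the arithmetic progression `t, t + 2ρ₁, t + 4ρ₁, …`: two consecutive points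
both see the point halfway between them, where the oscillation is taken. -/
theorem setLIntegral_Ioo_enorm_le_add_oscWithin (hρ₁ : ρ₁ ∈ Ioo 0 ρ) (n : ℕ)
    (hn : u + 2 * ρ₁ * (n + 1) ≤ v) :
    ∫⁻ t in Ioo u (u + 2 * ρ₁), ‖F t‖ₑ ≤
      (∫⁻ t in Ioo (u + 2 * ρ₁ * n) (u + 2 * ρ₁ * (n + 1)), ‖F t‖ₑ) +
        ∫⁻ t in Ioo (u + ρ₁) (u + ρ₁ + 2 * ρ₁ * n), oscWithin F (Ioo u v) ρ t := by
  obtain ⟨h0, hlt⟩ := hρ₁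
  induction n with
  | zero => simp
  | succ n ih =>
    push_cast at hn ⊢
    have hn0 : 0 ≤ 2 * ρ₁ * n := by positivity
    have hpt (t : ℝ) (ht : t ∈ Ioo (u + 2 * ρ₁ * n) (u + 2 * ρ₁ * (n + 1))) :
        ‖F t‖ₑ ≤ ‖F (t + 2 * ρ₁)‖ₑ + oscWithin F (Ioo u v) ρ (t + ρ₁) := by
      rw [← edist_zero_right, ← edist_zero_right, add_comm]
      refine (edist_triangle _ (F (t + 2 * ρ₁)) _).trans ?_
      gcongr
      apply edist_le_oscWithin <;> rw [Real.ball_eq_Ioo] <;> constructor <;> constructor <;>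
        linarith [ht.1, ht.2]
    have hstep := setLIntegral_mono' (μ := volume) measurableSet_Ioo hpt
    have hshift (k : ℝ) : u + 2 * ρ₁ * k + 2 * ρ₁ = u + 2 * ρ₁ * (k + 1) := by ring
    rw [lintegral_add_right _ (by fun_prop), setLIntegral_Ioo_comp_add_right (fun t => ‖F t‖ₑ),
      setLIntegral_Ioo_comp_add_right (oscWithin F (Ioo u v) ρ), hshift, hshift,
      add_right_comm u _ ρ₁, add_right_comm u _ ρ₁] at hstep
    grw [ih (by linarith), hstep]
    rw [add_assoc, add_comm (lintegral _ (oscWithin F (Ioo u v) ρ)),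
      setLIntegral_Ioo_add_setLIntegral_Ioo _ (by linarith) (by linarith)]

theorem exists_nat_mul_le_and_le_two_mul {d : ℝ} (hd : 0 < d) (hdL : d ≤ L) :
    ∃ N : ℕ, N ≠ 0 ∧ d * N ≤ L ∧ L ≤ 2 * (d * N) := by
  have hfloor : 1 ≤ ⌊L / d⌋₊ := (Nat.one_le_floor_iff _).2 ((one_le_div hd).2 hdL)
  have hlow : ⌊L / d⌋₊ ≤ L / d := Nat.floor_le (div_nonneg (hd.le.trans hdL) hd.le)
  have hupp : L / d < ⌊L / d⌋₊ + 1 := Nat.lt_floor_add_one _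
  have hone : (1 : ℝ) ≤ ⌊L / d⌋₊ := mod_cast hfloor
  rw [le_div_iff₀ hd] at hlow
  rw [div_lt_iff₀ hd] at hupp
  exact ⟨⌊L / d⌋₊, by lia, by linarith, by nlinarith⟩

theorem setLIntegral_Ioo_enorm_le_average (hρ₁ : ρ₁ ∈ Ioo 0 ρ) (hL : 2 * ρ₁ ≤ L) (hLv : u + L ≤ v) :
    ∫⁻ t in Ioo u (u + 2 * ρ₁), ‖F t‖ₑ ≤
      ENNReal.ofReal (4 * ρ₁ / L) * (∫⁻ t in Ioo u (u + L), ‖F t‖ₑ) +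
        ∫⁻ t in Ioo (u + ρ₁) (u + L), oscWithin F (Ioo u v) ρ t := by
  have h0 := hρ₁.1
  obtain ⟨N, hN0, hNL, hLN⟩ := exists_nat_mul_le_and_le_two_mul (by linarith : 0 < 2 * ρ₁) hL
  set W := ∫⁻ t in Ioo (u + ρ₁) (u + L), oscWithin F (Ioo u v) ρ t
  have hterm (n : ℕ) (hn : n ∈ Finset.range N) : ∫⁻ t in Ioo u (u + 2 * ρ₁), ‖F t‖ₑ ≤
      (∫⁻ t in Ioo (u + 2 * ρ₁ * n) (u + 2 * ρ₁ * (n + 1)), ‖F t‖ₑ) + W := by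
    have hnN : 2 * ρ₁ * (n + 1) ≤ 2 * ρ₁ * N := by
      gcongr
      exact_mod_cast Finset.mem_range.1 hn
    grw [setLIntegral_Ioo_enorm_le_add_oscWithin hρ₁ n (by linarith),
      (by linarith : u + ρ₁ + 2 * ρ₁ * n ≤ u + L)]
  have hsum := Finset.sum_le_sum hterm
  rw [Finset.sum_add_distrib, sum_setLIntegral_Ioo _ _ (by positivity)] at hsum
  simp only [Finset.sum_const, Finset.card_range, nsmul_eq_mul] at hsum
  refine (ENNReal.mul_le_mul_iff_right (Nat.cast_ne_zero.2 hN0) (ENNReal.natCast_ne_top N)).1 ?_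
  grw [hsum, hNL, mul_add, ← mul_assoc]
  gcongr
  refine le_mul_of_one_le_left' ?_
  rw [← ENNReal.ofReal_natCast, ← ENNReal.ofReal_mul (by positivity), ENNReal.one_le_ofReal,
    ← mul_div_assoc, one_le_div (by linarith)]
  linarith

theorem endpointBound_of_two_mul_le_length (hℓ : 0 < ℓ) (hρℓ : 2 * ρ ≤ ℓ) (A : ℝ) :
    EndpointBound E ℓ ρ A 1 0 (4 * ρ / ℓ) := by
  intro ρ₁ hρ₁ F u v huv
  obtain ⟨h0, hlt⟩ := hρ₁
  have hhalf : u + (v - u) / 2 = (u + v) / 2 := by ring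
  have hdiam : ENNReal.ofReal ρ₁ * Metric.ediam (F '' Ioo u (u + ρ)) ≤
      ∫⁻ t in Ioo u (u + ρ₁), oscWithin F (Ioo u v) ρ t :=
    ofReal_mul_ediam_image_Ioo_le hlt.le (by linarith)
  have hmass := setLIntegral_Ioo_enorm_le_average (F := F) (u := u) (v := v) (L := (v - u) / 2)
    ⟨h0, hlt⟩ (by linarith) (by linarith)
  rw [hhalf] at hmass
  grw [hdiam, hmass]
  rw [ENNReal.ofReal_one, one_mul, ENNReal.ofReal_zero, zero_mul, add_zero, add_comm (_ * _),
    ← add_assoc, setLIntegral_Ioo_add_setLIntegral_Ioo _ (by linarith) (by linarith)]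
  gcongr
  all_goals linarith

theorem div_rpow_add_mul_rpow_le {ε σ r k : ℝ} (hσ : 0 < σ) (hA : 0 < A) (hr : 0 < r)
    (hk : k * (r / A) ^ (1 - ε) ≤ 1) :
    (r / σ) ^ ε + k * (r / σ) / A * A ^ ε ≤ (σ ^ (-ε) + σ⁻¹) * r ^ ε := by
  have hsplit : r / A * A ^ ε = (r / A) ^ (1 - ε) * r ^ ε := by
    rw [Real.rpow_sub (by positivity), Real.rpow_one, Real.div_rpow hr.le hA.le]
    field_simp
  calc (r / σ) ^ ε + k * (r / σ) / A * A ^ ε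
      = σ ^ (-ε) * r ^ ε + σ⁻¹ * k * (r / A * A ^ ε) := by
        rw [Real.div_rpow hr.le hσ.le, Real.rpow_neg hσ.le]
        ring
    _ = σ ^ (-ε) * r ^ ε + σ⁻¹ * (k * (r / A) ^ (1 - ε)) * r ^ ε := by
        rw [hsplit]
        ring
    _ ≤ σ ^ (-ε) * r ^ ε + σ⁻¹ * 1 * r ^ ε := by gcongr
    _ = (σ ^ (-ε) + σ⁻¹) * r ^ ε := by ring

/- For `ε < 1` the factor `(r / A) ^ (1 - ε)` pays for the constant `3` of the averaging bound as
soon as `r ≤ c * A`; for larger `r` the crude bound `B = 1` is already of order `r ^ ε`. -/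
theorem exists_endpointBound_of_lt_one {ε σ : ℝ} (hε : ε ∈ Ioo 0 1) (hσ : 1 < σ) (hA : 0 < A)
    (hAℓ : 2 * A ≤ ℓ) :
    ∃ b ≥ 0, ∀ r ∈ Ioc 0 A, ∃ θ B : ℝ, 0 ≤ θ ∧ 0 ≤ B ∧ EndpointBound E ℓ (r / σ) A 0 θ B ∧
      (r / σ) ^ ε + θ * A ^ ε ≤ (σ ^ (-ε) + σ⁻¹) * r ^ ε ∧ B ≤ b * r ^ ε := by
  obtain ⟨hε0, hε1⟩ := hε
  have hσ0 : 0 < σ := by linarith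
  obtain ⟨c, hc0, hc1, hc⟩ : ∃ c : ℝ, 0 < c ∧ c ≤ 1 / 2 ∧ 3 * c ^ (1 - ε) ≤ 1 := by
    have hlim : Filter.Tendsto (fun c : ℝ => 3 * c ^ (1 - ε)) (nhds 0) (nhds 0) := by
      have := (Real.continuousAt_rpow_const 0 (1 - ε) (.inr (by linarith))).tendsto.const_mul 3
      rwa [Real.zero_rpow (by linarith), mul_zero] at this
    exact (eventually_mem_nhdsWithin.and ((eventually_nhdsWithin_of_eventually_nhds
      (eventually_le_nhds (by norm_num))).and (eventually_nhdsWithin_of_eventually_nhds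
      (hlim.eventually_le_const one_pos)))).exists (f := nhdsWithin (0 : ℝ) (Ioi 0))
  refine ⟨2 / (c * A) ^ ε, by positivity, fun r hr => ?_⟩
  have hr0 : 0 < r := hr.1
  have hdiv : r / σ ≤ r := div_le_self hr0.le hσ.le
  have hrA : r / A ≤ 1 := (div_le_one hA).2 hr.2
  rw [div_mul_eq_mul_div, mul_div_assoc, ← Real.div_rpow hr0.le (by positivity)]
  rcases le_total r (c * A) with hrc | hrc
  · refine ⟨3 * (r / σ) / A, 2 * (r / σ) / A, by positivity, by positivity,
      endpointBound_of_two_mul_le (by positivity) (by nlinarith) (by linarith),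
      div_rpow_add_mul_rpow_le hσ0 hA hr0 ?_, ?_⟩
    · grw [(div_le_iff₀ hA).2 hrc, hc]
    · calc 2 * (r / σ) / A ≤ 2 * (r / A) := by rw [mul_div_assoc]; gcongr
        _ ≤ 2 * (r / A) ^ ε := by
          gcongr
          exact Real.self_le_rpow_of_le_one (by positivity) hrA hε1.le
        _ ≤ 2 * (r / (c * A)) ^ ε := by
          gcongr
          nlinarith
  · refine ⟨r / σ / A, 1, by positivity, zero_le_one, endpointBound_of_le (hdiv.trans hr.2) hA
      (by linarith) (by linarith [hr.2]), ?_, ?_⟩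
    · have hone : 1 * (r / A) ^ (1 - ε) ≤ 1 := by
        rw [one_mul]
        exact Real.rpow_le_one (by positivity) hrA (by linarith)
      simpa using div_rpow_add_mul_rpow_le hσ0 hA hr0 hone
    · have := Real.one_le_rpow ((one_le_div (by positivity)).2 hrc) hε0.le
      linarith

theorem exists_endpointBound {ε σ : ℝ} (hε : ε ∈ Ioc 0 1) (hσ : 1 < σ) (hA : 0 < A)
    (hAℓ : 2 * A ≤ ℓ) :
    ∃ b ≥ 0, ∀ r ∈ Ioc 0 A, ∃ θ₁ θ₂ B : ℝ, 0 ≤ θ₁ ∧ 0 ≤ θ₂ ∧ 0 ≤ B ∧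
      EndpointBound E ℓ (r / σ) A θ₁ θ₂ B ∧
      (1 + θ₁) * (r / σ) ^ ε + θ₂ * A ^ ε ≤ (σ ^ (-ε) + σ⁻¹) * r ^ ε ∧ B ≤ b * r ^ ε := by
  rcases hε.2.eq_or_lt with rfl | hε1
  · have hℓ : 0 < ℓ := by linarith
    refine ⟨4 / ℓ, by positivity, fun r hr => ?_⟩
    have hr0 : 0 < r := hr.1
    have hdiv : r / σ ≤ r := div_le_self hr0.le hσ.le
    refine ⟨1, 0, 4 * (r / σ) / ℓ, zero_le_one, le_rfl, ?_,
      endpointBound_of_two_mul_le_length hℓ (by linarith [hr.2]) A, le_of_eq ?_, ?_⟩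
    · have : 0 < σ := one_pos.trans hσ
      positivity
    · simp only [Real.rpow_one, Real.rpow_neg_one]
      ring
    · rw [Real.rpow_one, div_mul_eq_mul_div]
      gcongr
  · obtain ⟨b, hb, h⟩ := exists_endpointBound_of_lt_one (E := E) ⟨hε.1, hε1⟩ hσ hA hAℓ
    refine ⟨b, hb, fun r hr => ?_⟩
    obtain ⟨θ, B, hθ, hB, hEnd, hle⟩ := h r hr
    exact ⟨0, θ, B, le_rfl, hθ, hB, hEnd, by rwa [add_zero, one_mul]⟩

end EndpointBound

section ExpandingBranch

variable {τ : ℝ → ℝ} {I : Set ℝ} {s t t₁ t₂ u v : ℝ}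

theorem hasDerivAt_of_le_abs_deriv (hs : 0 < s) (h : s ≤ |deriv τ t|) :
    HasDerivAt τ (deriv τ t) t :=
  (differentiableAt_of_deriv_ne_zero (abs_pos.1 (hs.trans_le h))).hasDerivAt

theorem mul_abs_sub_le_abs_sub (hs : 0 < s) (hI : I.OrdConnected)
    (hslope : ∀ t ∈ I, s ≤ |deriv τ t|) (ht₁ : t₁ ∈ I) (ht₂ : t₂ ∈ I) :
    s * |t₁ - t₂| ≤ |τ t₁ - τ t₂| := by
  wlog hlt : t₂ < t₁ generalizing t₁ t₂
  · rcases (not_lt.1 hlt).eq_or_lt with rfl | hlt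
    · simp
    · rw [abs_sub_comm, abs_sub_comm (τ t₁)]
      exact this ht₂ ht₁ hlt
  have hderiv (t : ℝ) (ht : t ∈ Icc t₂ t₁) : HasDerivAt τ (deriv τ t) t :=
    hasDerivAt_of_le_abs_deriv hs (hslope t (hI.out ht₂ ht₁ ht))
  obtain ⟨x, hx, hdx⟩ := exists_hasDerivAt_eq_slope τ (deriv τ) hlt
    (fun t ht => (hderiv t ht).continuousAt.continuousWithinAt)
    (fun t ht => hderiv t (Ioo_subset_Icc_self ht))
  have hslope_x := hslope x (hI.out ht₂ ht₁ (Ioo_subset_Icc_self hx))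
  rwa [hdx, abs_div, le_div_iff₀ (abs_pos.2 (sub_ne_zero.2 hlt.ne'))] at hslope_x

theorem injOn_of_le_abs_deriv (hs : 0 < s) (hI : I.OrdConnected)
    (hslope : ∀ t ∈ I, s ≤ |deriv τ t|) : InjOn τ I := by
  intro t₁ ht₁ t₂ ht₂ heq
  have h := mul_abs_sub_le_abs_sub hs hI hslope ht₁ ht₂
  rw [heq, sub_self, abs_zero] at h
  exact sub_eq_zero.1 (abs_nonpos_iff.1 (nonpos_of_mul_nonpos_right h hs))

theorem exists_image_Ioo_eq_of_monotoneOn (hs : 0 < s) (huv : u < v)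
    (hslope : ∀ t ∈ Ioo u v, s ≤ |deriv τ t|) (hmono : MonotoneOn τ (Ioo u v))
    (hbdd : Bornology.IsBounded (τ '' Ioo u v)) :
    ∃ c d, τ '' Ioo u v = Ioo c d ∧
      ∀ t ∈ Ioo u v, c + s * (t - u) ≤ τ t ∧ τ t + s * (v - t) ≤ d := by
  have hexp (t₁ t₂ : ℝ) (ht₁ : t₁ ∈ Ioo u v) (ht₂ : t₂ ∈ Ioo u v) (hle : t₁ ≤ t₂) :
      τ t₁ + s * (t₂ - t₁) ≤ τ t₂ := by
    have h := mul_abs_sub_le_abs_sub hs ordConnected_Ioo hslope ht₂ ht₁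
    rw [abs_of_nonneg (sub_nonneg.2 hle), abs_of_nonneg (sub_nonneg.2 (hmono ht₁ ht₂ hle))] at h
    linarith
  have hleft (t : ℝ) (ht : t ∈ Ioo u v) : sInf (τ '' Ioo u v) + s * (t - u) ≤ τ t := by
    have hsub : Ioo u t ⊆ {x | sInf (τ '' Ioo u v) + s * (t - x) ≤ τ t} := fun x hx => by
      have hx' : x ∈ Ioo u v := ⟨hx.1, hx.2.trans ht.2⟩
      have h := hexp x t hx' ht hx.2.le
      grw [← csInf_le hbdd.bddBelow (mem_image_of_mem τ hx')] at h
      exact h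
    exact closure_minimal hsub (isClosed_le (by fun_prop) (by fun_prop))
      (closure_Ioo ht.1.ne ▸ left_mem_Icc.2 ht.1.le)
  have hright (t : ℝ) (ht : t ∈ Ioo u v) : τ t + s * (v - t) ≤ sSup (τ '' Ioo u v) := by
    have hsub : Ioo t v ⊆ {x | τ t + s * (x - t) ≤ sSup (τ '' Ioo u v)} := fun x hx => by
      have hx' : x ∈ Ioo u v := ⟨ht.1.trans hx.1, hx.2⟩
      exact (hexp t x ht hx' hx.1.le).trans (le_csSup hbdd.bddAbove (mem_image_of_mem τ hx'))
    exact closure_minimal hsub (isClosed_le (by fun_prop) (by fun_prop))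
      (closure_Ioo ht.2.ne ▸ right_mem_Icc.2 ht.2.le)
  refine ⟨_, _, Subset.antisymm ?_ fun z hz => ?_, fun t ht => ⟨hleft t ht, hright t ht⟩⟩
  · rintro _ ⟨t, ht, rfl⟩
    constructor
    · nlinarith [hleft t ht, ht.1]
    · nlinarith [hright t ht, ht.2]
  · have hne : (τ '' Ioo u v).Nonempty := (nonempty_Ioo.2 huv).image τ
    obtain ⟨x, hx, hxz⟩ := exists_lt_of_csInf_lt hne hz.1
    obtain ⟨y, hy, hzy⟩ := exists_lt_of_lt_csSup hne hz.2
    have hcont : ContinuousOn τ (Ioo u v) := fun t ht =>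
      (hasDerivAt_of_le_abs_deriv hs (hslope t ht)).continuousAt.continuousWithinAt
    exact (isPreconnected_Ioo.image τ hcont).ordConnected.out hx hy ⟨hxz.le, hzy.le⟩

theorem exists_image_Ioo_eq_of_antitoneOn (hs : 0 < s) (huv : u < v)
    (hslope : ∀ t ∈ Ioo u v, s ≤ |deriv τ t|) (hanti : AntitoneOn τ (Ioo u v))
    (hbdd : Bornology.IsBounded (τ '' Ioo u v)) :
    ∃ c d, τ '' Ioo u v = Ioo c d ∧
      ∀ t ∈ Ioo u v, c + s * (v - t) ≤ τ t ∧ τ t + s * (t - u) ≤ d := by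
  have himage : (-τ) '' Ioo u v = -(τ '' Ioo u v) := by
    rw [← image_neg_eq_neg, image_image]
    rfl
  obtain ⟨c, d, hcd, h⟩ := exists_image_Ioo_eq_of_monotoneOn (τ := -τ) hs huv
    (fun t ht => by simpa [deriv.neg] using hslope t ht) hanti.neg (by rw [himage]; exact hbdd.neg)
  refine ⟨-d, -c, by rw [← neg_Ioo, ← hcd, himage, neg_neg], fun t ht => ?_⟩
  obtain ⟨h₁, h₂⟩ := h t ht
  rw [Pi.neg_apply] at h₁ h₂
  constructor <;> linarith

theorem exists_image_Ioo_eq_and_subset_image (hs : 0 < s) (huv : u < v)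
    (hslope : ∀ t ∈ Ioo u v, s ≤ |deriv τ t|)
    (hmono : MonotoneOn τ (Ioo u v) ∨ AntitoneOn τ (Ioo u v))
    (hbdd : Bornology.IsBounded (τ '' Ioo u v)) :
    ∃ c d, τ '' Ioo u v = Ioo c d ∧ s * (v - u) ≤ d - c ∧
      ((∀ ρ ≤ v - u, Ioo c (c + s * ρ) ⊆ τ '' Ioo u (u + ρ) ∧
          Ioo (d - s * ρ) d ⊆ τ '' Ioo (v - ρ) v) ∨
        (∀ ρ ≤ v - u, Ioo c (c + s * ρ) ⊆ τ '' Ioo (v - ρ) v ∧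
          Ioo (d - s * ρ) d ⊆ τ '' Ioo u (u + ρ))) := by
  have hmid : (u + v) / 2 ∈ Ioo u v := by constructor <;> linarith
  rcases hmono with hmono | hanti
  · obtain ⟨c, d, hcd, h⟩ := exists_image_Ioo_eq_of_monotoneOn hs huv hslope hmono hbdd
    have hlen : s * (v - u) ≤ d - c := by linarith [h _ hmid]
    refine ⟨c, d, hcd, hlen, .inl fun ρ hρ => ⟨fun z hz => ?_, fun z hz => ?_⟩⟩
    all_goals
      obtain ⟨t, ht, rfl⟩ := hcd.ge (⟨by nlinarith [hz.1], by nlinarith [hz.2]⟩ : z ∈ Ioo c d)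
      refine mem_image_of_mem τ ⟨?_, ?_⟩ <;> nlinarith [h t ht, hz.1, hz.2, ht.1, ht.2]
  · obtain ⟨c, d, hcd, h⟩ := exists_image_Ioo_eq_of_antitoneOn hs huv hslope hanti hbdd
    have hlen : s * (v - u) ≤ d - c := by linarith [h _ hmid]
    refine ⟨c, d, hcd, hlen, .inr fun ρ hρ => ⟨fun z hz => ?_, fun z hz => ?_⟩⟩
    all_goals
      obtain ⟨t, ht, rfl⟩ := hcd.ge (⟨by nlinarith [hz.1], by nlinarith [hz.2]⟩ : z ∈ Ioo c d)
      refine mem_image_of_mem τ ⟨?_, ?_⟩ <;> nlinarith [h t ht, hz.1, hz.2, ht.1, ht.2]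

end ExpandingBranch

section BranchTransfer

variable {E : Type*} [NormedAddCommGroup E] [NormedSpace ℝ E] {τ : ℝ → ℝ} {f g : ℝ → E}
  {I K₁ K₂ S S₁ S₂ : Set ℝ} {A B d₁ d₂ r s t t₁ t₂ u v η ℓ ρ ρ₁ θ₁ θ₂ : ℝ}

/-- The transfer operator of the single branch `τ|_I`: the density `f` on `I` is pushed forward
along `τ` and extended by zero outside `τ '' I`. -/
noncomputable def branchTransfer (τ : ℝ → ℝ) (I : Set ℝ) (f : ℝ → E) : ℝ → E :=
  (τ '' I).indicator fun z =>
    |deriv τ (Function.invFunOn τ I z)|⁻¹ • f (Function.invFunOn τ I z)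

theorem branchTransfer_apply (hinj : InjOn τ I) (ht : t ∈ I) :
    branchTransfer τ I f (τ t) = |deriv τ t|⁻¹ • f t := by
  rw [branchTransfer, indicator_of_mem (mem_image_of_mem τ ht), hinj.leftInvOn_invFunOn ht]

theorem setLIntegral_enorm_branchTransfer (hs : 0 < s) (hinj : InjOn τ I)
    (hslope : ∀ t ∈ I, s ≤ |deriv τ t|) (hS : MeasurableSet S) (hSI : S ⊆ I) :
    ∫⁻ z in τ '' S, ‖branchTransfer τ I f z‖ₑ = ∫⁻ t in S, ‖f t‖ₑ := by
  rw [lintegral_image_eq_lintegral_abs_deriv_mul hS (fun t ht =>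
    (hasDerivAt_of_le_abs_deriv hs (hslope t (hSI ht))).hasDerivWithinAt) (hinj.mono hSI)]
  refine setLIntegral_congr_fun hS fun t ht => ?_
  have hpos : 0 < |deriv τ t| := hs.trans_le (hslope t (hSI ht))
  rw [branchTransfer_apply hinj (hSI ht), enorm_smul, Real.enorm_of_nonneg (by positivity),
    ← mul_assoc, ← ENNReal.ofReal_mul hpos.le, mul_inv_cancel₀ hpos.ne', ENNReal.ofReal_one,
    one_mul]

theorem lintegral_enorm_branchTransfer (hs : 0 < s) (hinj : InjOn τ I)
    (hslope : ∀ t ∈ I, s ≤ |deriv τ t|) (hI : MeasurableSet I) :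
    ∫⁻ z, ‖branchTransfer τ I f z‖ₑ = ∫⁻ t in I, ‖f t‖ₑ := by
  rw [← setLIntegral_enorm_branchTransfer hs hinj hslope hI Subset.rfl]
  refine (setLIntegral_eq_of_support_subset fun z hz => ?_).symm
  exact mem_of_indicator_ne_zero (enorm_ne_zero.1 hz)

theorem integrable_branchTransfer (hs : 0 < s) (hinj : InjOn τ I)
    (hslope : ∀ t ∈ I, s ≤ |deriv τ t|) (hI : MeasurableSet I) (hf : IntegrableOn f I) :
    Integrable (branchTransfer τ I f) := by
  have hderiv (t : ℝ) (ht : t ∈ I) : HasDerivWithinAt τ (deriv τ t) I t :=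
    (hasDerivAt_of_le_abs_deriv hs (hslope t ht)).hasDerivWithinAt
  have hJ : MeasurableSet (τ '' I) :=
    hI.image_of_continuousOn_injOn (fun t ht => (hderiv t ht).continuousWithinAt) hinj
  have hint : IntegrableOn (branchTransfer τ I f) (τ '' I) := by
    rw [integrableOn_image_iff_integrableOn_abs_deriv_smul hI hderiv hinj]
    refine hf.congr_fun (fun t ht => ?_) hI
    rw [branchTransfer_apply hinj ht,
      smul_inv_smul₀ (hs.trans_le (hslope t ht)).ne']
  rwa [← integrable_indicator_iff hJ, branchTransfer, indicator_indicator, inter_self] at hint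

theorem branchTransfer_congr_ae (hτ : DifferentiableOn ℝ τ I) (hI : MeasurableSet I)
    (hfg : f =ᵐ[volume.restrict I] g) : branchTransfer τ I f =ᵐ[volume] branchTransfer τ I g := by
  have hnull : volume ({t | f t ≠ g t} ∩ I) = 0 := by
    rw [← Measure.restrict_apply' hI]
    exact hfg
  have himage : volume (τ '' ({t | f t ≠ g t} ∩ I)) = 0 :=
    addHaar_image_eq_zero_of_differentiableOn_of_addHaar_eq_zero volume
      (hτ.mono inter_subset_right) hnull
  refine measure_mono_null (fun z (hz : branchTransfer τ I f z ≠ branchTransfer τ I g z) => ?_)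
    himage
  have hzI : z ∈ τ '' I := by
    by_contra hzI
    exact hz (by simp only [branchTransfer, indicator_of_notMem hzI])
  refine ⟨Function.invFunOn τ I z, ⟨fun heq => hz ?_, Function.invFunOn_mem hzI⟩,
    Function.invFunOn_eq hzI⟩
  simp only [branchTransfer, indicator_of_mem hzI, heq]

theorem edist_inv_smul_inv_smul_le (hd₁ : 0 < d₁) (hd₂ : 1 ≤ d₂) (h : |d₁ - d₂| ≤ η)
    (x y : E) :
    edist (d₁⁻¹ • x) (d₂⁻¹ • y) ≤
      ENNReal.ofReal d₁⁻¹ * (edist x y + ENNReal.ofReal η * ‖y‖ₑ) := by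
  have hd₂0 : 0 < d₂ := by linarith
  have hsplit : d₁⁻¹ • x - d₂⁻¹ • y = d₁⁻¹ • ((x - y) - ((d₁ - d₂) * d₂⁻¹) • y) := by
    rw [smul_sub, smul_sub, smul_smul, sub_sub, ← add_smul]
    congr 2
    field_simp
    ring
  have hcoef : ‖(d₁ - d₂) * d₂⁻¹‖ₑ ≤ ENNReal.ofReal η := by
    rw [← ofReal_norm, Real.norm_eq_abs, abs_mul, abs_inv, abs_of_pos hd₂0]
    exact ENNReal.ofReal_le_ofReal
      ((mul_le_of_le_one_right (abs_nonneg _) (inv_le_one_of_one_le₀ hd₂)).trans h)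
  rw [edist_eq_enorm_sub, edist_eq_enorm_sub, hsplit, enorm_smul,
    Real.enorm_of_nonneg (by positivity)]
  grw [enorm_sub_le, enorm_smul, hcoef]

theorem edist_branchTransfer_le (hinj : InjOn τ I) (hslope : ∀ t ∈ I, 1 ≤ |deriv τ t|)
    (ht₁ : t₁ ∈ I) (ht₂ : t₂ ∈ I) (h : |deriv τ t₁ - deriv τ t₂| ≤ η) :
    edist (branchTransfer τ I f (τ t₁)) (branchTransfer τ I f (τ t₂)) ≤
      ENNReal.ofReal |deriv τ t₁|⁻¹ * (edist (f t₁) (f t₂) + ENNReal.ofReal η * ‖f t₂‖ₑ) := by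
  rw [branchTransfer_apply hinj ht₁, branchTransfer_apply hinj ht₂]
  exact edist_inv_smul_inv_smul_le (one_pos.trans_le (hslope t₁ ht₁)) (hslope t₂ ht₂)
    ((abs_abs_sub_abs_le _ _).trans h) _ _

theorem ofReal_inv_le_inv_mul_one_add (hd₁ : 1 ≤ d₁) (hd₂ : 0 < d₂) (h : |d₁ - d₂| ≤ η) :
    ENNReal.ofReal d₁⁻¹ ≤ (ENNReal.ofReal d₂)⁻¹ * (1 + ENNReal.ofReal η) := by
  have hη : 0 ≤ η := (abs_nonneg _).trans h
  rw [← ENNReal.ofReal_inv_of_pos hd₂, ← ENNReal.ofReal_one, ← ENNReal.ofReal_add zero_le_one hη,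
    ← ENNReal.ofReal_mul (by positivity)]
  refine ENNReal.ofReal_le_ofReal ?_
  rw [← div_eq_inv_mul, inv_le_iff_one_le_mul₀ (by linarith), div_mul_eq_mul_div, one_le_div hd₂]
  nlinarith [(abs_le.1 h).1]

theorem edist_branchTransfer_le_oscWithin (hs : 1 ≤ s) (hI : I.OrdConnected)
    (hslope : ∀ t ∈ I, s ≤ |deriv τ t|)
    (hη : ∀ t₁ ∈ I, ∀ t₂ ∈ I, |t₁ - t₂| < 2 * (r / s) → |deriv τ t₁ - deriv τ t₂| ≤ η)
    (ht : t ∈ I) (ht₁ : t₁ ∈ I) (ht₂ : t₂ ∈ I) (h₁ : |t₁ - t| < r / s)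
    (h₂ : |t₂ - t| < r / s) :
    edist (branchTransfer τ I f (τ t₁)) (branchTransfer τ I f (τ t₂)) ≤
      (ENNReal.ofReal |deriv τ t|)⁻¹ * ((1 + ENNReal.ofReal η) ^ 2 *
        (oscWithin f I (r / s) t + ENNReal.ofReal η * ‖f t‖ₑ)) := by
  have hone (t : ℝ) (ht : t ∈ I) : 1 ≤ |deriv τ t| := hs.trans (hslope t ht)
  have hr : 0 < r / s := (abs_nonneg _).trans_lt h₁
  have hmem {y : ℝ} (hy : y ∈ I) (hyt : |y - t| < r / s) : y ∈ Metric.ball t (r / s) ∩ I :=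
    ⟨hyt, hy⟩
  have hosc := edist_le_oscWithin (f := f) (hmem ht₁ h₁) (hmem ht₂ h₂)
  have hval : ‖f t₂‖ₑ ≤ oscWithin f I (r / s) t + ‖f t‖ₑ := by
    rw [← edist_zero_right, ← edist_zero_right]
    exact (edist_triangle _ (f t) _).trans (add_le_add_left (edist_le_oscWithin (hmem ht₂ h₂)
      ⟨Metric.mem_ball_self hr, ht⟩) _)
  have h12 : |t₁ - t₂| < 2 * (r / s) := by
    rw [abs_sub_comm] at h₂
    linarith [abs_sub_le t₁ t t₂]
  grw [edist_branchTransfer_le (injOn_of_le_abs_deriv (by linarith) hI hslope) hone ht₁ ht₂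
    (hη t₁ ht₁ t₂ ht₂ h12), ofReal_inv_le_inv_mul_one_add (hone t₁ ht₁)
    (one_pos.trans_le (hone t ht)) ((abs_abs_sub_abs_le _ _).trans
      (hη t₁ ht₁ t ht (by linarith))), hosc, hval]
  rw [mul_assoc, pow_two, mul_assoc]
  gcongr
  calc oscWithin f I (r / s) t + ENNReal.ofReal η * (oscWithin f I (r / s) t + ‖f t‖ₑ)
      = (1 + ENNReal.ofReal η) * oscWithin f I (r / s) t + 1 * (ENNReal.ofReal η * ‖f t‖ₑ) := by
        ring
    _ ≤ (1 + ENNReal.ofReal η) * oscWithin f I (r / s) t +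
        (1 + ENNReal.ofReal η) * (ENNReal.ofReal η * ‖f t‖ₑ) := by
        gcongr
        exact le_self_add
    _ = _ := by ring

theorem setLIntegral_oscWithin_branchTransfer_le (hs : 1 ≤ s) (hI : I.OrdConnected)
    (hslope : ∀ t ∈ I, s ≤ |deriv τ t|)
    (hη : ∀ t₁ ∈ I, ∀ t₂ ∈ I, |t₁ - t₂| < 2 * (r / s) → |deriv τ t₁ - deriv τ t₂| ≤ η) :
    ∫⁻ z in τ '' I, oscWithin (branchTransfer τ I f) (τ '' I) r z ≤
      (1 + ENNReal.ofReal η) ^ 2 *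
        ((∫⁻ t in I, oscWithin f I (r / s) t) + ENNReal.ofReal η * ∫⁻ t in I, ‖f t‖ₑ) := by
  have hs0 : 0 < s := by linarith
  have hmeas : MeasurableSet I := hI.measurableSet
  rw [lintegral_image_eq_lintegral_abs_deriv_mul hmeas (fun t ht =>
    (hasDerivAt_of_le_abs_deriv hs0 (hslope t ht)).hasDerivWithinAt)
    (injOn_of_le_abs_deriv hs0 hI hslope)]
  have hpt (t : ℝ) (ht : t ∈ I) :
      ENNReal.ofReal |deriv τ t| * oscWithin (branchTransfer τ I f) (τ '' I) r (τ t) ≤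
        (1 + ENNReal.ofReal η) ^ 2 * (oscWithin f I (r / s) t + ENNReal.ofReal η * ‖f t‖ₑ) := by
    have hclose (y : ℝ) (hy : y ∈ I) (hyt : τ y ∈ Metric.ball (τ t) r) : |y - t| < r / s :=
      (lt_div_iff₀' hs0).2 ((mul_abs_sub_le_abs_sub hs0 hI hslope hy ht).trans_lt hyt)
    rw [ENNReal.mul_le_iff_le_inv (by simpa using (hs0.trans_le (hslope t ht)).ne')
      ENNReal.ofReal_ne_top]
    refine Metric.ediam_image_le_iff.2 ?_
    rintro _ ⟨h₁, t₁, ht₁, rfl⟩ _ ⟨h₂, t₂, ht₂, rfl⟩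
    exact edist_branchTransfer_le_oscWithin hs hI hslope hη ht ht₁ ht₂ (hclose t₁ ht₁ h₁)
      (hclose t₂ ht₂ h₂)
  refine (setLIntegral_mono' hmeas hpt).trans_eq ?_
  rw [lintegral_const_mul' _ _ (by finiteness), lintegral_add_left (by fun_prop),
    lintegral_const_mul' _ _ (by finiteness)]

theorem ofReal_mul_ediam_image_branchTransfer_le (hs : 1 ≤ s) (hinj : InjOn τ I)
    (hslope : ∀ t ∈ I, s ≤ |deriv τ t|) (hη : ∀ t₁ ∈ S₁, ∀ t₂ ∈ S₁, |deriv τ t₁ - deriv τ t₂| ≤ η)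
    (hS₁ : S₁ ⊆ I) (hS : MeasurableSet S) (hSS₁ : S ⊆ S₁) (hρ : volume S = ENNReal.ofReal ρ)
    (hK₁ : K₁ ⊆ τ '' S₁) :
    ENNReal.ofReal (s * ρ) * Metric.ediam (branchTransfer τ I f '' K₁) ≤
      (1 + ENNReal.ofReal η) * (ENNReal.ofReal ρ * Metric.ediam (f '' S₁)) +
        ENNReal.ofReal η * ∫⁻ t in I, ‖f t‖ₑ := by
  have hs0 : 0 < s := by linarith
  suffices hpt : ∀ t₁ ∈ S₁, ∀ t₂ ∈ S₁, ENNReal.ofReal (s * ρ) *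
        edist (branchTransfer τ I f (τ t₁)) (branchTransfer τ I f (τ t₂)) ≤
      (1 + ENNReal.ofReal η) * (ENNReal.ofReal ρ * Metric.ediam (f '' S₁)) +
        ENNReal.ofReal η * ∫⁻ t in I, ‖f t‖ₑ by
    simp only [Metric.ediam, ENNReal.mul_iSup, iSup_le_iff] at hpt ⊢
    rintro _ ⟨_, h₁, rfl⟩ _ ⟨_, h₂, rfl⟩
    obtain ⟨t₁, ht₁, rfl⟩ := hK₁ h₁
    obtain ⟨t₂, ht₂, rfl⟩ := hK₁ h₂
    exact hpt t₁ ht₁ t₂ ht₂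
  intro t₁ ht₁ t₂ ht₂
  have hslope₁ : ENNReal.ofReal s * ENNReal.ofReal |deriv τ t₁|⁻¹ ≤ 1 := by
    rw [← ENNReal.ofReal_mul hs0.le, ENNReal.ofReal_le_one, ← div_eq_mul_inv]
    exact div_le_one_of_le₀ (hslope t₁ (hS₁ ht₁)) (abs_nonneg _)
  have hmass := measure_mul_enorm_le (μ := volume) (g := f) hS hSS₁ ht₂
  rw [hρ] at hmass
  calc _ ≤ ENNReal.ofReal (s * ρ) * (ENNReal.ofReal |deriv τ t₁|⁻¹ *
        (edist (f t₁) (f t₂) + ENNReal.ofReal η * ‖f t₂‖ₑ)) := by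
        gcongr
        exact edist_branchTransfer_le hinj (fun t ht => hs.trans (hslope t ht)) (hS₁ ht₁)
          (hS₁ ht₂) (hη t₁ ht₁ t₂ ht₂)
    _ = ENNReal.ofReal s * ENNReal.ofReal |deriv τ t₁|⁻¹ * (ENNReal.ofReal ρ *
        edist (f t₁) (f t₂) + ENNReal.ofReal η * (ENNReal.ofReal ρ * ‖f t₂‖ₑ)) := by
        rw [ENNReal.ofReal_mul hs0.le]
        ring
    _ ≤ 1 * (ENNReal.ofReal ρ * Metric.ediam (f '' S₁) + ENNReal.ofReal η *
        ((∫⁻ t in I, ‖f t‖ₑ) + ENNReal.ofReal ρ * Metric.ediam (f '' S₁))) := by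
        grw [hslope₁, hmass, hSS₁.trans hS₁,
          Metric.edist_le_ediam_of_mem (mem_image_of_mem f ht₁) (mem_image_of_mem f ht₂)]
    _ = _ := by ring

theorem endTerm_branchTransfer_le (hs : 1 ≤ s) (hinj : InjOn τ I)
    (hslope : ∀ t ∈ I, s ≤ |deriv τ t|) (hη : ∀ t₁ ∈ S₁, ∀ t₂ ∈ S₁, |deriv τ t₁ - deriv τ t₂| ≤ η)
    (hS₁ : S₁ ⊆ I) (hS : MeasurableSet S) (hSS₁ : S ⊆ S₁) (hρ : volume S = ENNReal.ofReal ρ)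
    (hK₁ : K₁ ⊆ τ '' S₁) (hS₂ : MeasurableSet S₂) (hS₂I : S₂ ⊆ I) (hK₂ : K₂ ⊆ τ '' S₂) :
    ENNReal.ofReal (s * ρ) * Metric.ediam (branchTransfer τ I f '' K₁) +
        ∫⁻ z in K₂, ‖branchTransfer τ I f z‖ₑ ≤
      (1 + ENNReal.ofReal η) * (ENNReal.ofReal ρ * Metric.ediam (f '' S₁) + ∫⁻ t in S₂, ‖f t‖ₑ) +
        ENNReal.ofReal η * ∫⁻ t in I, ‖f t‖ₑ := by
  grw [ofReal_mul_ediam_image_branchTransfer_le hs hinj hslope hη hS₁ hS hSS₁ hρ hK₁, hK₂,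
    setLIntegral_enorm_branchTransfer (by linarith) hinj hslope hS₂ hS₂I, mul_add, add_right_comm]
  gcongr
  exact le_mul_of_one_le_left' le_self_add

theorem endTerms_branchTransfer_le (hs : 1 ≤ s) (hinj : InjOn τ (Ioo u v))
    (hslope : ∀ t ∈ Ioo u v, s ≤ |deriv τ t|)
    (hη : ∀ t₁ ∈ Ioo u v, ∀ t₂ ∈ Ioo u v, |t₁ - t₂| < 2 * ρ → |deriv τ t₁ - deriv τ t₂| ≤ η)
    (hρ₁ : ρ₁ ∈ Ioo 0 ρ) (hρ : 2 * ρ ≤ v - u) :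
    (∀ K₁ ⊆ τ '' Ioo u (u + ρ), ∀ K₂ ⊆ τ '' Ioo u (u + 2 * ρ₁),
      ENNReal.ofReal (s * ρ₁) * Metric.ediam (branchTransfer τ (Ioo u v) f '' K₁) +
          ∫⁻ z in K₂, ‖branchTransfer τ (Ioo u v) f z‖ₑ ≤
        (1 + ENNReal.ofReal η) * (ENNReal.ofReal ρ₁ * Metric.ediam (f '' Ioo u (u + ρ)) +
          ∫⁻ t in Ioo u (u + 2 * ρ₁), ‖f t‖ₑ) +
        ENNReal.ofReal η * ∫⁻ t in Ioo u v, ‖f t‖ₑ) ∧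
    (∀ K₁ ⊆ τ '' Ioo (v - ρ) v, ∀ K₂ ⊆ τ '' Ioo (v - 2 * ρ₁) v,
      ENNReal.ofReal (s * ρ₁) * Metric.ediam (branchTransfer τ (Ioo u v) f '' K₁) +
          ∫⁻ z in K₂, ‖branchTransfer τ (Ioo u v) f z‖ₑ ≤
        (1 + ENNReal.ofReal η) * (ENNReal.ofReal ρ₁ * Metric.ediam (f '' Ioo (v - ρ) v) +
          ∫⁻ t in Ioo (v - 2 * ρ₁) v, ‖f t‖ₑ) +
        ENNReal.ofReal η * ∫⁻ t in Ioo u v, ‖f t‖ₑ) := by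
  obtain ⟨h0, hlt⟩ := hρ₁
  have hclose {x : ℝ} (hI : Ioo x (x + ρ) ⊆ Ioo u v) :
      ∀ t₁ ∈ Ioo x (x + ρ), ∀ t₂ ∈ Ioo x (x + ρ), |deriv τ t₁ - deriv τ t₂| ≤ η :=
    fun t₁ ht₁ t₂ ht₂ => hη t₁ (hI ht₁) t₂ (hI ht₂)
      (abs_lt.2 ⟨by linarith [ht₁.1, ht₂.2], by linarith [ht₁.2, ht₂.1]⟩)
  constructor <;> intro K₁ hK₁ K₂ hK₂
  · have hI : Ioo u (u + ρ) ⊆ Ioo u v := Ioo_subset_Ioo_right (by linarith)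
    exact endTerm_branchTransfer_le hs hinj hslope (hclose hI) hI
      (measurableSet_Ioo (a := u) (b := u + ρ₁)) (Ioo_subset_Ioo_right (by linarith))
      (by rw [Real.volume_Ioo, add_sub_cancel_left]) hK₁ measurableSet_Ioo
      (Ioo_subset_Ioo_right (by linarith)) hK₂
  · have hI : Ioo (v - ρ) v ⊆ Ioo u v := Ioo_subset_Ioo_left (by linarith)
    refine endTerm_branchTransfer_le hs hinj hslope ?_ hI
      (measurableSet_Ioo (a := v - ρ₁) (b := v)) (Ioo_subset_Ioo_left (by linarith))
      (by rw [Real.volume_Ioo, sub_sub_cancel]) hK₁ measurableSet_Ioo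
      (Ioo_subset_Ioo_left (by linarith)) hK₂
    simpa only [sub_add_cancel] using hclose (x := v - ρ) (by rwa [sub_add_cancel])

theorem lintegral_oscWithin_branchTransfer_le_endTerms (hs : 1 ≤ s) (huv : u < v)
    (hslope : ∀ t ∈ Ioo u v, s ≤ |deriv τ t|)
    (hmono : MonotoneOn τ (Ioo u v) ∨ AntitoneOn τ (Ioo u v))
    (hbdd : Bornology.IsBounded (τ '' Ioo u v))
    (hη : ∀ t₁ ∈ Ioo u v, ∀ t₂ ∈ Ioo u v, |t₁ - t₂| < 2 * ρ → |deriv τ t₁ - deriv τ t₂| ≤ η)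
    (hρ₁ : ρ₁ ∈ Ioo 0 ρ) (hρ : 2 * ρ ≤ v - u) :
    ∫⁻ z, oscWithin (branchTransfer τ (Ioo u v) f) univ (s * ρ₁) z ≤
      (1 + ENNReal.ofReal η) ^ 2 *
        ((∫⁻ t in Ioo u v, oscWithin f (Ioo u v) ρ t) +
          ENNReal.ofReal η * ∫⁻ t in Ioo u v, ‖f t‖ₑ) +
      ((1 + ENNReal.ofReal η) *
        ((ENNReal.ofReal ρ₁ * Metric.ediam (f '' Ioo u (u + ρ)) +
          ∫⁻ t in Ioo u (u + 2 * ρ₁), ‖f t‖ₑ) +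
        (ENNReal.ofReal ρ₁ * Metric.ediam (f '' Ioo (v - ρ) v) +
          ∫⁻ t in Ioo (v - 2 * ρ₁) v, ‖f t‖ₑ)) +
        2 * (ENNReal.ofReal η * ∫⁻ t in Ioo u v, ‖f t‖ₑ)) := by
  have hs0 : 0 < s := by linarith
  have hinj := injOn_of_le_abs_deriv hs0 ordConnected_Ioo hslope
  obtain ⟨hu, hv⟩ := endTerms_branchTransfer_le (f := f) hs hinj hslope hη hρ₁ hρ
  have hdiv : s * ρ / s = ρ := mul_div_cancel_left₀ ρ hs0.ne'
  have hint := setLIntegral_oscWithin_branchTransfer_le (f := f) (r := s * ρ) hs ordConnected_Ioo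
    hslope (by rwa [hdiv])
  rw [hdiv] at hint
  obtain ⟨c, d, hcd, hlen, hsub⟩ := exists_image_Ioo_eq_and_subset_image hs0 huv hslope hmono hbdd
  have hassoc : 2 * (s * ρ₁) = s * (2 * ρ₁) := by ring
  obtain ⟨h0, hlt⟩ := hρ₁
  have hzero := lintegral_oscWithin_univ_le (h := branchTransfer τ (Ioo u v) f) (c := c) (d := d)
    (r := s * ρ₁) (r' := s * ρ) (fun z hz => indicator_of_notMem (hcd ▸ hz) _) (by positivity)
    (by gcongr) (by nlinarith)
  rw [hassoc, ← hcd] at hzero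
  refine hzero.trans (add_le_add hint ?_)
  have hle : ρ ≤ v - u := by linarith
  have hle₁ : 2 * ρ₁ ≤ v - u := by linarith
  rcases hsub with h | h
  · exact (add_le_add (hu _ (h ρ hle).1 _ (h (2 * ρ₁) hle₁).1)
      (hv _ (h ρ hle).2 _ (h (2 * ρ₁) hle₁).2)).trans_eq (by ring)
  · exact (add_le_add (hv _ (h ρ hle).1 _ (h (2 * ρ₁) hle₁).1)
      (hu _ (h ρ hle).2 _ (h (2 * ρ₁) hle₁).2)).trans_eq (by ring)

theorem lintegral_oscWithin_branchTransfer_le (hEnd : EndpointBound E ℓ ρ A θ₁ θ₂ B) (hs : 1 ≤ s)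
    (hslope : ∀ t ∈ Ioo u v, s ≤ |deriv τ t|)
    (hmono : MonotoneOn τ (Ioo u v) ∨ AntitoneOn τ (Ioo u v))
    (hbdd : Bornology.IsBounded (τ '' Ioo u v))
    (hη : ∀ t₁ ∈ Ioo u v, ∀ t₂ ∈ Ioo u v, |t₁ - t₂| < 2 * ρ → |deriv τ t₁ - deriv τ t₂| ≤ η)
    (hρ : 0 < ρ) (hρℓ : ρ ≤ ℓ) (huv : 2 * ℓ ≤ v - u) :
    ∫⁻ z, oscWithin (branchTransfer τ (Ioo u v) f) univ (s * ρ) z ≤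
      (1 + ENNReal.ofReal η) ^ 2 *
        ((1 + ENNReal.ofReal θ₁) * (∫⁻ t in Ioo u v, oscWithin f (Ioo u v) ρ t) +
          ENNReal.ofReal θ₂ * (∫⁻ t in Ioo u v, oscWithin f (Ioo u v) A t) +
          (3 * ENNReal.ofReal η + ENNReal.ofReal B) * ∫⁻ t in Ioo u v, ‖f t‖ₑ) := by
  have hs0 : 0 < s := by linarith
  refine lintegral_oscWithin_le_of_forall_lt (by positivity) fun r hr => ?_
  have hρ₁ : r / s ∈ Ioo 0 ρ := ⟨div_pos hr.1 hs0, (div_lt_iff₀' hs0).2 hr.2⟩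
  have h := lintegral_oscWithin_branchTransfer_le_endTerms (f := f) hs (by linarith) hslope hmono
    hbdd hη hρ₁ (by linarith)
  rw [mul_div_cancel₀ r hs0.ne'] at h
  grw [h, hEnd.add_le (hρ.le.trans hρℓ) hρ₁ f huv]
  set k : ℝ≥0∞ := 1 + ENNReal.ofReal η
  have hk : 1 ≤ k := le_self_add
  have hk₁ (x : ℝ≥0∞) : k * x ≤ k ^ 2 * x := by
    rw [pow_two, mul_assoc]
    exact le_mul_of_one_le_left' hk
  have hk₂ (x : ℝ≥0∞) : x ≤ k ^ 2 * x := le_mul_of_one_le_left' (one_le_pow₀ hk)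
  grw [hk₁ (_ + _ + _), hk₂ (2 * _)]
  exact le_of_eq (by ring)

end BranchTransfer

section FrobeniusPerron

variable {f : ℝ → ℂ} {ε σ A B η ℓ ρ θ₁ θ₂ : ℝ} {τ : ℝ → ℝ} {q : ℕ} {a : Fin (q + 1) → ℝ}
  {s : Fin q → ℝ}

theorem osc_eq_oscWithin (f : ℝ → ℂ) (r : ℝ) : osc f r = oscWithin f (Icc 0 1) r := by
  ext x
  simp only [osc, relBall, oscWithin, Metric.ediam, iSup_image, Real.ball_eq_Ioo,
    edist_eq_enorm_sub]

theorem oscOne_eq_lintegral_oscWithin (f : ℝ → ℂ) (r : ℝ) :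
    oscOne f r = ∫⁻ x, oscWithin f (Icc 0 1) r x ∂lebI := by
  rw [oscOne, osc_eq_oscWithin]

theorem frobeniusPerron_eq_sum_branchTransfer (τ : ℝ → ℝ) (a : Fin (q + 1) → ℝ) (f : ℝ → ℂ) :
    frobeniusPerron τ a f = ∑ i, branchTransfer τ (piece a i) f := by
  ext x
  simp only [frobeniusPerron, Finset.sum_apply, branchTransfer, Complex.real_smul,
    Complex.ofReal_inv, div_eq_inv_mul]

theorem pairwise_disjoint_piece (ha : Monotone a) :
    Pairwise (Function.onFun Disjoint (piece a)) := by
  have h := ha.pairwise_disjoint_on_Ioo_succ.comp_of_injective (Fin.castSucc_injective q)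
  refine fun i j hij => ?_
  simpa only [Function.onFun, Fin.orderSucc_castSucc, piece] using h hij

namespace IsPiecewiseExpanding

theorem piece_subset (hτ : IsPiecewiseExpanding ε τ a s) (i : Fin q) : piece a i ⊆ Icc 0 1 := by
  rw [← hτ.first, ← hτ.last]
  exact Ioo_subset_Icc_self.trans (Icc_subset_Icc (hτ.strictMono.monotone (Fin.zero_le _))
    (hτ.strictMono.monotone (Fin.le_last _)))

theorem sum_setLIntegral_piece_le (hτ : IsPiecewiseExpanding ε τ a s) (G : ℝ → ℝ≥0∞) :
    ∑ i, ∫⁻ t in piece a i, G t ≤ ∫⁻ t, G t ∂lebI := by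
  rw [← tsum_fintype (L := .unconditional _), ← lintegral_iUnion (s := piece a)
    (fun i => measurableSet_Ioo) (pairwise_disjoint_piece hτ.strictMono.monotone)]
  exact lintegral_mono_set (iUnion_subset hτ.piece_subset)

theorem pos (hτ : IsPiecewiseExpanding ε τ a s) (i : Fin q) : 0 < s i :=
  one_pos.trans (hτ.one_lt i)

theorem injOn (hτ : IsPiecewiseExpanding ε τ a s) (i : Fin q) : InjOn τ (piece a i) :=
  injOn_of_le_abs_deriv (hτ.pos i) ordConnected_Ioo (hτ.slope i)

theorem integrable_branchTransfer (hτ : IsPiecewiseExpanding ε τ a s) (hf : Integrable f lebI)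
    (i : Fin q) : Integrable (branchTransfer τ (piece a i) f) :=
  _root_.integrable_branchTransfer (hτ.pos i) (hτ.injOn i) (hτ.slope i) measurableSet_Ioo
    (IntegrableOn.mono_set hf (hτ.piece_subset i))

theorem memLp_frobeniusPerron (hτ : IsPiecewiseExpanding ε τ a s) (hf : MemLp f 1 lebI) :
    MemLp (frobeniusPerron τ a f) 1 lebI := by
  rw [memLp_one_iff_integrable] at hf ⊢
  rw [frobeniusPerron_eq_sum_branchTransfer]
  exact integrable_finsetSum' _ fun i _ => (hτ.integrable_branchTransfer hf i).restrict

theorem eLpNorm_frobeniusPerron_le (hτ : IsPiecewiseExpanding ε τ a s) (hf : MemLp f 1 lebI) :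
    eLpNorm (frobeniusPerron τ a f) 1 lebI ≤ eLpNorm f 1 lebI := by
  have hmeas (i : Fin q) : AEStronglyMeasurable (branchTransfer τ (piece a i) f) volume :=
    (hτ.integrable_branchTransfer (memLp_one_iff_integrable.1 hf) i).aestronglyMeasurable
  calc eLpNorm (frobeniusPerron τ a f) 1 lebI
      ≤ eLpNorm (∑ i, branchTransfer τ (piece a i) f) 1 volume := by
        rw [frobeniusPerron_eq_sum_branchTransfer]
        exact eLpNorm_mono_measure _ Measure.restrict_le_self
    _ ≤ ∑ i, eLpNorm (branchTransfer τ (piece a i) f) 1 volume :=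
        eLpNorm_sum_le (fun i _ => hmeas i) le_rfl
    _ = ∑ i, ∫⁻ t in piece a i, ‖f t‖ₑ := by
        simp only [eLpNorm_one_eq_lintegral_enorm]
        exact Finset.sum_congr rfl fun i _ => lintegral_enorm_branchTransfer (hτ.pos i)
          (hτ.injOn i) (hτ.slope i) measurableSet_Ioo
    _ ≤ eLpNorm f 1 lebI := by
        rw [eLpNorm_one_eq_lintegral_enorm]
        exact hτ.sum_setLIntegral_piece_le _

theorem frobeniusPerron_congr_ae (hτ : IsPiecewiseExpanding ε τ a s) {f g : ℝ → ℂ}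
    (hfg : f =ᵐ[lebI] g) : frobeniusPerron τ a f =ᵐ[lebI] frobeniusPerron τ a g := by
  have hbranch (i : Fin q) :
      branchTransfer τ (piece a i) f =ᵐ[lebI] branchTransfer τ (piece a i) g :=
    ae_restrict_of_ae (branchTransfer_congr_ae (fun t ht => (hasDerivAt_of_le_abs_deriv (hτ.pos i)
      (hτ.slope i t ht)).differentiableAt.differentiableWithinAt) measurableSet_Ioo
      (ae_restrict_of_ae_restrict_of_subset (hτ.piece_subset i) hfg))
  filter_upwards [ae_all_iff.2 hbranch] with x hx
  simp only [frobeniusPerron_eq_sum_branchTransfer, Finset.sum_apply, hx]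

theorem lintegral_oscWithin_branchTransfer_le (hτ : IsPiecewiseExpanding ε τ a s)
    (hEnd : EndpointBound ℂ ℓ ρ A θ₁ θ₂ B) (hσ : 1 ≤ σ) (hσs : ∀ i, σ ≤ s i)
    (hℓ : ∀ i : Fin q, 2 * ℓ ≤ a i.succ - a i.castSucc) (hρ : 0 < ρ) (hρℓ : ρ ≤ ℓ)
    (hη : ∀ i, ∀ t₁ ∈ piece a i, ∀ t₂ ∈ piece a i, |t₁ - t₂| < 2 * ρ →
      |deriv τ t₁ - deriv τ t₂| ≤ η) (i : Fin q) :
    ∫⁻ z, oscWithin (branchTransfer τ (piece a i) f) (Icc 0 1) (σ * ρ) z ∂lebI ≤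
      (1 + ENNReal.ofReal η) ^ 2 *
        ((1 + ENNReal.ofReal θ₁) * (∫⁻ t in piece a i, oscWithin f (Icc 0 1) ρ t) +
          ENNReal.ofReal θ₂ * (∫⁻ t in piece a i, oscWithin f (Icc 0 1) A t) +
          (3 * ENNReal.ofReal η + ENNReal.ofReal B) * ∫⁻ t in piece a i, ‖f t‖ₑ) := by
  have hsub := hτ.piece_subset i
  have hbdd : Bornology.IsBounded (τ '' piece a i) :=
    (Metric.isBounded_Icc 0 1).subset ((image_mono hsub).trans hτ.mapsTo.image_subset)
  have hbranch := _root_.lintegral_oscWithin_branchTransfer_le (f := f) hEnd hσ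
    (fun t ht => (hσs i).trans (hτ.slope i t ht)) (hτ.monotone i) hbdd (hη i) hρ hρℓ (hℓ i)
  have hmono (r : ℝ) : ∫⁻ t in piece a i, oscWithin f (piece a i) r t ≤
      ∫⁻ t in piece a i, oscWithin f (Icc 0 1) r t :=
    lintegral_mono fun t => oscWithin_mono hsub le_rfl
  calc ∫⁻ z, oscWithin (branchTransfer τ (piece a i) f) (Icc 0 1) (σ * ρ) z ∂lebI
      ≤ ∫⁻ z, oscWithin (branchTransfer τ (piece a i) f) univ (σ * ρ) z :=
        (setLIntegral_le_lintegral _ _).trans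
          (lintegral_mono fun z => oscWithin_mono (subset_univ _) le_rfl)
    _ ≤ _ := hbranch
    _ ≤ _ := by
        grw [← hmono ρ, ← hmono A]
        rfl

theorem oscOne_frobeniusPerron_le (hτ : IsPiecewiseExpanding ε τ a s)
    (hEnd : EndpointBound ℂ ℓ ρ A θ₁ θ₂ B) (hσ : 1 ≤ σ) (hσs : ∀ i, σ ≤ s i)
    (hℓ : ∀ i : Fin q, 2 * ℓ ≤ a i.succ - a i.castSucc) (hρ : 0 < ρ) (hρℓ : ρ ≤ ℓ)
    (hη : ∀ i, ∀ t₁ ∈ piece a i, ∀ t₂ ∈ piece a i, |t₁ - t₂| < 2 * ρ →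
      |deriv τ t₁ - deriv τ t₂| ≤ η) (f : ℝ → ℂ) :
    oscOne (frobeniusPerron τ a f) (σ * ρ) ≤ (1 + ENNReal.ofReal η) ^ 2 *
      ((1 + ENNReal.ofReal θ₁) * oscOne f ρ + ENNReal.ofReal θ₂ * oscOne f A +
        (3 * ENNReal.ofReal η + ENNReal.ofReal B) * eLpNorm f 1 lebI) := by
  simp only [oscOne_eq_lintegral_oscWithin, eLpNorm_one_eq_lintegral_enorm]
  calc ∫⁻ x, oscWithin (frobeniusPerron τ a f) (Icc 0 1) (σ * ρ) x ∂lebI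
      ≤ ∫⁻ x, ∑ i, oscWithin (branchTransfer τ (piece a i) f) (Icc 0 1) (σ * ρ) x ∂lebI := by
        rw [frobeniusPerron_eq_sum_branchTransfer]
        exact lintegral_mono fun x => oscWithin_sum_le _ _ _ _ _
    _ = ∑ i, ∫⁻ x, oscWithin (branchTransfer τ (piece a i) f) (Icc 0 1) (σ * ρ) x ∂lebI :=
        lintegral_finsetSum _ fun i _ => by fun_prop
    _ ≤ _ := Finset.sum_le_sum fun i _ =>
        hτ.lintegral_oscWithin_branchTransfer_le hEnd hσ hσs hℓ hρ hρℓ hη i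
    _ ≤ _ := by
        simp only [← Finset.mul_sum, Finset.sum_add_distrib]
        grw [hτ.sum_setLIntegral_piece_le, hτ.sum_setLIntegral_piece_le,
          hτ.sum_setLIntegral_piece_le]

end IsPiecewiseExpanding

end FrobeniusPerron

section Variation

variable {f : ℝ → ℂ} {p A A₁ r δ : ℝ}

theorem edist_le_natCast_mul_of_convex {X Y : Type*} [NormedAddCommGroup X] [NormedSpace ℝ X]
    [PseudoEMetricSpace Y] {g : X → Y} {U : Set X} {K : ℝ≥0∞} (hU : Convex ℝ U)
    (h : ∀ x ∈ U, ∀ y ∈ U, dist x y ≤ δ → edist (g x) (g y) ≤ K) (n : ℕ) {x y : X} (hx : x ∈ U)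
    (hy : y ∈ U) (hxy : dist x y ≤ n * δ) : edist (g x) (g y) ≤ n * K := by
  induction n generalizing y with
  | zero =>
    obtain rfl : x = y := dist_le_zero.1 (by simpa using hxy)
    simp
  | succ n ih =>
    have hn : (0 : ℝ) < n + 1 := by positivity
    push_cast at hxy ⊢
    set z := AffineMap.lineMap x y ((n : ℝ) / (n + 1))
    have hz : z ∈ U := hU.lineMap_mem hx hy
      ⟨by positivity, div_le_one_of_le₀ (by linarith) hn.le⟩
    have hxz : dist x z ≤ n * δ := by
      rw [dist_left_lineMap, Real.norm_of_nonneg (by positivity), div_mul_eq_mul_div,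
        div_le_iff₀ hn]
      nlinarith
    have hzy : dist z y ≤ δ := by
      have hcoef : 1 - (n : ℝ) / (n + 1) = 1 / (n + 1) := by
        field_simp
        ring
      rw [dist_lineMap_right, hcoef, Real.norm_of_nonneg (by positivity), div_mul_eq_mul_div,
        div_le_iff₀ hn]
      linarith
    calc edist (g x) (g y) ≤ edist (g x) (g z) + edist (g z) (g y) := edist_triangle _ _ _
      _ ≤ n * K + K := add_le_add (ih hz hxz) (h z hz y hy hzy)
      _ = (n + 1) * K := by ring

theorem ofReal_mul_edist_le_oscOne (hδ : δ ≤ 1 / 2) (hδA : 2 * δ ≤ A) {y y' : ℝ}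
    (hy : y ∈ Icc 0 1) (hy' : y' ∈ Icc 0 1) (hyy' : dist y y' ≤ δ) :
    ENNReal.ofReal δ * edist (f y) (f y') ≤ oscOne f A := by
  rw [Real.dist_eq, abs_le] at hyy'
  obtain ⟨z, hyz, hzy, hz⟩ : ∃ z, y - δ ≤ z ∧ z ≤ y ∧ Ioo z (z + δ) ⊆ Icc 0 1 := by
    rcases le_total y (1 / 2) with h | h
    · exact ⟨y, by linarith, le_rfl, fun t ht => ⟨hy.1.trans ht.1.le, by linarith [ht.2]⟩⟩
    · exact ⟨y - δ, le_rfl, by linarith, fun t ht => ⟨by linarith [ht.1], by linarith [ht.2, hy.2]⟩⟩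
  have hK : ∀ t ∈ Ioo z (z + δ), {y, y'} ⊆ Metric.ball t A ∩ Icc 0 1 := by
    rintro t ⟨ht₁, ht₂⟩
    rw [Real.ball_eq_Ioo, pair_subset_iff]
    exact ⟨⟨⟨by linarith, by linarith⟩, hy⟩, ⟨by linarith, by linarith⟩, hy'⟩
  calc ENNReal.ofReal δ * edist (f y) (f y')
      = volume (Ioo z (z + δ)) * Metric.ediam (f '' {y, y'}) := by
        rw [Real.volume_Ioo, add_sub_cancel_left, image_pair, Metric.ediam_pair]
    _ ≤ ∫⁻ t in Ioo z (z + δ), oscWithin f (Icc 0 1) A t :=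
        measure_mul_ediam_image_le measurableSet_Ioo hK
    _ ≤ oscOne f A := by
        rw [oscOne_eq_lintegral_oscWithin]
        exact lintegral_mono_set hz

theorem oscOne_le_ediam_image (f : ℝ → ℂ) (r : ℝ) :
    oscOne f r ≤ Metric.ediam (f '' Icc 0 1) := by
  rw [oscOne_eq_lintegral_oscWithin]
  calc ∫⁻ x, oscWithin f (Icc 0 1) r x ∂lebI
      ≤ ∫⁻ _, Metric.ediam (f '' Icc 0 1) ∂lebI :=
        lintegral_mono fun x => Metric.ediam_mono (image_mono inter_subset_right)
    _ = Metric.ediam (f '' Icc 0 1) := by simp [lebI]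

theorem exists_oscOne_le (hA₁ : 0 < A₁) :
    ∃ C > 0, ∀ (f : ℝ → ℂ) (r : ℝ), oscOne f r ≤ ENNReal.ofReal C * oscOne f A₁ := by
  obtain ⟨δ, hδ, hδ₁, hδA⟩ : ∃ δ > 0, δ ≤ 1 / 2 ∧ 2 * δ ≤ A₁ :=
    ⟨min (1 / 2) (A₁ / 2), by positivity, min_le_left _ _,
      by linarith [min_le_right (1 / 2) (A₁ / 2)]⟩
  obtain ⟨n, hn⟩ := exists_nat_gt (1 / δ)
  have hn0 : (0 : ℝ) < n := (by positivity : 0 < 1 / δ).trans hn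
  refine ⟨n * δ⁻¹, by positivity, fun f r => (oscOne_le_ediam_image f r).trans ?_⟩
  refine Metric.ediam_image_le_iff.2 fun y hy y' hy' => ?_
  have hlocal : ∀ x ∈ Icc (0 : ℝ) 1, ∀ x' ∈ Icc (0 : ℝ) 1, dist x x' ≤ δ →
      edist (f x) (f x') ≤ ENNReal.ofReal δ⁻¹ * oscOne f A₁ := by
    intro x hx x' hx' hxx'
    rw [ENNReal.ofReal_inv_of_pos hδ,
      ← ENNReal.mul_le_iff_le_inv (ENNReal.ofReal_pos.2 hδ).ne' ENNReal.ofReal_ne_top]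
    exact ofReal_mul_edist_le_oscOne hδ₁ hδA hx hx' hxx'
  have hdist : dist y y' ≤ n * δ := by
    rw [div_lt_iff₀ hδ] at hn
    exact (Real.dist_le_of_mem_Icc_01 hy hy').trans hn.le
  calc edist (f y) (f y') ≤ n * (ENNReal.ofReal δ⁻¹ * oscOne f A₁) :=
        edist_le_natCast_mul_of_convex (convex_Icc 0 1) hlocal n hy hy' hdist
    _ = ENNReal.ofReal (n * δ⁻¹) * oscOne f A₁ := by
        rw [ENNReal.ofReal_mul n.cast_nonneg, ENNReal.ofReal_natCast, mul_assoc]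

theorem ofReal_rpow_ne_zero (hr : 0 < r) (ε : ℝ) : ENNReal.ofReal (r ^ ε) ≠ 0 :=
  (ENNReal.ofReal_pos.2 (Real.rpow_pos_of_pos hr ε)).ne'

theorem varFun_le_iff {C : ℝ≥0∞} :
    varFun A p f ≤ C ↔ ∀ r ∈ Ioc 0 A, oscOne f r ≤ C * ENNReal.ofReal (r ^ (1 / p)) :=
  iSup₂_le_iff.trans (forall₂_congr fun _ hr =>
    ENNReal.div_le_iff (ofReal_rpow_ne_zero hr.1 _) ENNReal.ofReal_ne_top)

theorem oscOne_le_varFun_mul (hr : r ∈ Ioc 0 A) :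
    oscOne f r ≤ varFun A p f * ENNReal.ofReal (r ^ (1 / p)) :=
  varFun_le_iff.1 le_rfl r hr

theorem exists_varFun_le (hp : 0 ≤ p) (hA₁ : 0 < A₁) (A : ℝ) :
    ∃ C > 0, ∀ f : ℝ → ℂ, varFun A p f ≤ ENNReal.ofReal C * varFun A₁ p f := by
  obtain ⟨C, -, hC⟩ := exists_oscOne_le hA₁
  refine ⟨max 1 C, by positivity, fun f => varFun_le_iff.2 fun r hr => ?_⟩
  rcases le_total r A₁ with hrA | hrA
  · calc oscOne f r ≤ varFun A₁ p f * ENNReal.ofReal (r ^ (1 / p)) :=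
          oscOne_le_varFun_mul ⟨hr.1, hrA⟩
      _ ≤ ENNReal.ofReal (max 1 C) * varFun A₁ p f * ENNReal.ofReal (r ^ (1 / p)) := by
          gcongr
          exact le_mul_of_one_le_left' (ENNReal.one_le_ofReal.2 (le_max_left _ _))
  · calc oscOne f r ≤ ENNReal.ofReal C * oscOne f A₁ := hC f r
      _ ≤ ENNReal.ofReal C * (varFun A₁ p f * ENNReal.ofReal (A₁ ^ (1 / p))) := by
          gcongr
          exact oscOne_le_varFun_mul ⟨hA₁, le_rfl⟩
      _ ≤ ENNReal.ofReal (max 1 C) * varFun A₁ p f * ENNReal.ofReal (r ^ (1 / p)) := by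
          rw [mul_assoc]
          gcongr
          exact le_max_right _ _

theorem le_mul_varClass_add {c X Y : ℝ≥0∞} (hc : c ≠ 0) (hc' : c ≠ ∞)
    (h : ∀ g, g =ᵐ[lebI] f → X ≤ c * varFun A p g + Y) : X ≤ c * varClass A p f + Y := by
  rw [← tsub_le_iff_right, mul_comm, ← ENNReal.div_le_iff hc hc']
  refine le_iInf₂ fun g hg => ?_
  rw [ENNReal.div_le_iff hc hc', tsub_le_iff_right, mul_comm]
  exact h g hg

theorem varClass_le_varFun {g : ℝ → ℂ} (hg : g =ᵐ[lebI] f) : varClass A p f ≤ varFun A p g :=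
  iInf₂_le g hg

theorem varClass_mono (hA : A₁ ≤ A) (p : ℝ) (f : ℝ → ℂ) : varClass A₁ p f ≤ varClass A p f :=
  iInf₂_mono fun _ _ => biSup_mono fun _ hr => ⟨hr.1, hr.2.trans hA⟩

theorem exists_varClass_le (hp : 0 ≤ p) (hA₁ : 0 < A₁) (A : ℝ) :
    ∃ C > 0, ∀ f : ℝ → ℂ, varClass A p f ≤ ENNReal.ofReal C * varClass A₁ p f := by
  obtain ⟨C, hC, hvar⟩ := exists_varFun_le hp hA₁ A
  refine ⟨C, hC, fun f => ?_⟩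
  rw [← add_zero (ENNReal.ofReal C * _)]
  refine le_mul_varClass_add (ENNReal.ofReal_pos.2 hC).ne' ENNReal.ofReal_ne_top fun g hg => ?_
  rw [add_zero]
  exact (varClass_le_varFun hg).trans (hvar g)

theorem MemBV.of_varClass_le {g : ℝ → ℂ} {α β : ℝ} (hf : MemBV A p f) (hg : MemLp g 1 lebI)
    (h : varClass A p g ≤
      ENNReal.ofReal α * varClass A p f + ENNReal.ofReal β * eLpNorm f 1 lebI) :
    MemBV A p g :=
  ⟨hg, h.trans_lt (ENNReal.add_lt_top.2 ⟨ENNReal.mul_lt_top ENNReal.ofReal_lt_top hf.2,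
    ENNReal.mul_lt_top ENNReal.ofReal_lt_top hf.1.2⟩)⟩

end Variation

namespace IsPiecewiseExpanding

variable {f : ℝ → ℂ} {p ε σ e A B M α η ℓ ρ θ₁ θ₂ : ℝ} {τ : ℝ → ℝ} {q : ℕ}
  {a : Fin (q + 1) → ℝ} {s : Fin q → ℝ}

theorem exists_two_mul_le_length (hτ : IsPiecewiseExpanding ε τ a s) :
    ∃ ℓ > 0, ∀ i : Fin q, 2 * ℓ ≤ a i.succ - a i.castSucc := by
  have hlen (i : Fin q) : 0 < a i.succ - a i.castSucc :=
    sub_pos.2 (hτ.strictMono Fin.castSucc_lt_succ)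
  rcases isEmpty_or_nonempty (Fin q) with hq | hq
  · exact ⟨1, one_pos, isEmptyElim⟩
  · obtain ⟨i₀, hi₀⟩ := Finite.exists_min fun i : Fin q => a i.succ - a i.castSucc
    exact ⟨(a i₀.succ - a i₀.castSucc) / 2, half_pos (hlen i₀), fun i => by linarith [hi₀ i]⟩

theorem exists_abs_deriv_sub_le (hτ : IsPiecewiseExpanding ε τ a s) (hε : 0 ≤ ε) :
    ∃ M > 0, ∀ ρ, ∀ i, ∀ t₁ ∈ piece a i, ∀ t₂ ∈ piece a i, |t₁ - t₂| < 2 * ρ →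
      |deriv τ t₁ - deriv τ t₂| ≤ M * ρ ^ ε := by
  choose m hm using hτ.holder
  refine ⟨(1 + ∑ i, |m i|) * 2 ^ ε, by positivity, fun ρ i t₁ ht₁ t₂ ht₂ ht => ?_⟩
  have hρ : 0 ≤ ρ := by linarith [abs_nonneg (t₁ - t₂)]
  have hmi : m i ≤ 1 + ∑ j, |m j| := by
    linarith [le_abs_self (m i), Finset.single_le_sum (fun j _ => abs_nonneg (m j))
      (Finset.mem_univ i)]
  calc |deriv τ t₁ - deriv τ t₂| ≤ m i * |t₁ - t₂| ^ ε := hm i t₁ ht₁ t₂ ht₂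
    _ ≤ (1 + ∑ i, |m i|) * (2 * ρ) ^ ε := by gcongr
    _ = (1 + ∑ i, |m i|) * 2 ^ ε * ρ ^ ε := by
        rw [Real.mul_rpow zero_le_two hρ, mul_assoc]

theorem oscOne_frobeniusPerron_le_varFun (hτ : IsPiecewiseExpanding ε τ a s)
    (hEnd : EndpointBound ℂ ℓ ρ A θ₁ θ₂ B) (hσ : 1 ≤ σ) (hσs : ∀ i, σ ≤ s i)
    (hℓ : ∀ i : Fin q, 2 * ℓ ≤ a i.succ - a i.castSucc) (hρ : 0 < ρ) (hρA : ρ ≤ A) (hρℓ : ρ ≤ ℓ)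
    (hη : ∀ i, ∀ t₁ ∈ piece a i, ∀ t₂ ∈ piece a i, |t₁ - t₂| < 2 * ρ →
      |deriv τ t₁ - deriv τ t₂| ≤ η)
    (hη₀ : 0 ≤ η) (hθ₁ : 0 ≤ θ₁) (hθ₂ : 0 ≤ θ₂) (hB : 0 ≤ B) (f : ℝ → ℂ) :
    oscOne (frobeniusPerron τ a f) (σ * ρ) ≤
      ENNReal.ofReal ((1 + η) ^ 2 * ((1 + θ₁) * ρ ^ (1 / p) + θ₂ * A ^ (1 / p))) * varFun A p f +
        ENNReal.ofReal ((1 + η) ^ 2 * (3 * η + B)) * eLpNorm f 1 lebI := by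
  have hA : 0 < A := hρ.trans_le hρA
  grw [hτ.oscOne_frobeniusPerron_le hEnd hσ hσs hℓ hρ hρℓ hη f,
    oscOne_le_varFun_mul (p := p) ⟨hρ, hρA⟩, oscOne_le_varFun_mul (p := p) ⟨hA, le_rfl⟩]
  have hη' : ENNReal.ofReal ((1 + η) ^ 2) = (1 + ENNReal.ofReal η) ^ 2 := by
    rw [ENNReal.ofReal_pow (by positivity), ENNReal.ofReal_add zero_le_one hη₀, ENNReal.ofReal_one]
  have hθ₁' : ENNReal.ofReal (1 + θ₁) = 1 + ENNReal.ofReal θ₁ := by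
    rw [ENNReal.ofReal_add zero_le_one hθ₁, ENNReal.ofReal_one]
  have hη3 : ENNReal.ofReal (3 * η) = 3 * ENNReal.ofReal η := by
    rw [ENNReal.ofReal_mul zero_le_three, ENNReal.ofReal_ofNat]
  rw [ENNReal.ofReal_mul (by positivity), ENNReal.ofReal_mul (by positivity), hη',
    ENNReal.ofReal_add (by positivity) (by positivity), ENNReal.ofReal_mul (by positivity),
    ENNReal.ofReal_mul hθ₂, hθ₁', ENNReal.ofReal_add (by positivity) hB, hη3]
  exact le_of_eq (by ring)

theorem exists_varFun_frobeniusPerron_le_of_small (hτ : IsPiecewiseExpanding (1 / p) τ a s)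
    (hp : 1 ≤ p) (hσ : 1 < σ) (hσs : ∀ i, σ ≤ s i)
    (hℓ : ∀ i : Fin q, 2 * ℓ ≤ a i.succ - a i.castSucc) (hM : 0 < M)
    (hHolder : ∀ ρ, ∀ i, ∀ t₁ ∈ piece a i, ∀ t₂ ∈ piece a i, |t₁ - t₂| < 2 * ρ →
      |deriv τ t₁ - deriv τ t₂| ≤ M * ρ ^ (1 / p))
    (hA : 0 < A) (hAℓ : 2 * A ≤ ℓ) (hAe : M * A ^ (1 / p) ≤ e)
    (hα : (1 + e) ^ 2 * (σ ^ (-(1 / p)) + σ⁻¹) ≤ α) :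
    ∃ β > 0, ∀ f : ℝ → ℂ, varFun A p (frobeniusPerron τ a f) ≤
      ENNReal.ofReal α * varFun A p f + ENNReal.ofReal β * eLpNorm f 1 lebI := by
  have hε : 1 / p ∈ Ioc 0 1 := ⟨by positivity, div_le_one_of_le₀ hp (by linarith)⟩
  have hσ₀ : 0 < σ := one_pos.trans hσ
  have he : 0 ≤ e := le_trans (by positivity) hAe
  have hα₀ : 0 ≤ α := le_trans (by positivity) hα
  obtain ⟨b, hb, hbound⟩ := exists_endpointBound (E := ℂ) hε hσ hA hAℓ
  refine ⟨(1 + e) ^ 2 * (3 * M + b), by positivity, fun f => varFun_le_iff.2 fun r hr => ?_⟩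
  obtain ⟨θ₁, θ₂, B, hθ₁, hθ₂, hB, hEnd, hvar, hBr⟩ := hbound r hr
  have hr₀ : 0 < r := hr.1
  have hρ : 0 < r / σ := div_pos hr₀ hσ₀
  have hρr : r / σ ≤ r := div_le_self hr₀.le hσ.le
  set η := M * (r / σ) ^ (1 / p)
  have hη₀ : 0 ≤ η := by positivity
  have hηr : η ≤ M * r ^ (1 / p) :=
    mul_le_mul_of_nonneg_left (Real.rpow_le_rpow hρ.le hρr hε.1.le) hM.le
  have hηe : η ≤ e := hηr.trans (le_trans (by gcongr; exact hr.2) hAe)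
  have hosc := hτ.oscOne_frobeniusPerron_le_varFun (p := p) hEnd hσ.le hσs hℓ hρ
    (hρr.trans hr.2) (by linarith [hr.2]) (hHolder (r / σ)) hη₀ hθ₁ hθ₂ hB f
  rw [mul_div_cancel₀ r hσ₀.ne'] at hosc
  have hcoef₁ : (1 + η) ^ 2 * ((1 + θ₁) * (r / σ) ^ (1 / p) + θ₂ * A ^ (1 / p)) ≤
      α * r ^ (1 / p) := by
    calc (1 + η) ^ 2 * ((1 + θ₁) * (r / σ) ^ (1 / p) + θ₂ * A ^ (1 / p))
        ≤ (1 + e) ^ 2 * ((σ ^ (-(1 / p)) + σ⁻¹) * r ^ (1 / p)) := by gcongr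
      _ ≤ α * r ^ (1 / p) := by
        rw [← mul_assoc]
        gcongr
  have hcoef₂ : (1 + η) ^ 2 * (3 * η + B) ≤ (1 + e) ^ 2 * (3 * M + b) * r ^ (1 / p) := by
    calc (1 + η) ^ 2 * (3 * η + B)
        ≤ (1 + e) ^ 2 * (3 * (M * r ^ (1 / p)) + b * r ^ (1 / p)) := by gcongr
      _ = (1 + e) ^ 2 * (3 * M + b) * r ^ (1 / p) := by ring
  grw [hosc, hcoef₁, hcoef₂]
  rw [ENNReal.ofReal_mul hα₀, ENNReal.ofReal_mul (by positivity)]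
  exact le_of_eq (by ring)

theorem exists_varFun_frobeniusPerron_le (hτ : IsPiecewiseExpanding (1 / p) τ a s) (hp : 1 ≤ p)
    (hσ : 1 < σ) (hσs : ∀ i, σ ≤ s i) (hα : σ ^ (-(1 / p)) + σ⁻¹ < α) :
    ∃ A₀ > 0, ∀ A ∈ Ioc 0 A₀, ∃ β > 0, ∀ f : ℝ → ℂ, varFun A p (frobeniusPerron τ a f) ≤
      ENNReal.ofReal α * varFun A p f + ENNReal.ofReal β * eLpNorm f 1 lebI := by
  have hp₀ : 0 < 1 / p := by positivity
  obtain ⟨e, hα', he⟩ : ∃ e, (1 + e) ^ 2 * (σ ^ (-(1 / p)) + σ⁻¹) < α ∧ 0 < e := by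
    have hlim : ∀ᶠ e in nhds 0, (1 + e) ^ 2 * (σ ^ (-(1 / p)) + σ⁻¹) < α :=
      ContinuousAt.eventually_lt (by fun_prop) continuousAt_const (by simpa using hα)
    exact ((hlim.filter_mono nhdsWithin_le_nhds).and
      (self_mem_nhdsWithin (a := (0 : ℝ)) (s := Ioi 0))).exists
  obtain ⟨ℓ, hℓ₀, hℓ⟩ := hτ.exists_two_mul_le_length
  obtain ⟨M, hM, hHolder⟩ := hτ.exists_abs_deriv_sub_le hp₀.le
  refine ⟨min (ℓ / 2) ((e / M) ^ (1 / p)⁻¹), by positivity, fun A hA => ?_⟩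
  have hAe : M * A ^ (1 / p) ≤ e := by
    rw [← le_div_iff₀' hM, ← Real.le_rpow_inv_iff_of_pos hA.1.le (by positivity) hp₀]
    exact hA.2.trans (min_le_right _ _)
  exact hτ.exists_varFun_frobeniusPerron_le_of_small hp hσ hσs hℓ hM hHolder hA.1
    (by linarith [hA.2.trans (min_le_left _ _)]) hAe hα'.le

theorem exists_varClass_frobeniusPerron_le (hτ : IsPiecewiseExpanding (1 / p) τ a s) (hp : 1 ≤ p)
    (hσ : 1 < σ) (hσs : ∀ i, σ ≤ s i) (hα : σ ^ (-(1 / p)) + σ⁻¹ < α) :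
    ∃ A₀ > 0, ∀ A ∈ Ioc 0 A₀, ∃ β > 0, ∀ f : ℝ → ℂ, varClass A p (frobeniusPerron τ a f) ≤
      ENNReal.ofReal α * varClass A p f + ENNReal.ofReal β * eLpNorm f 1 lebI := by
  obtain ⟨A₀, hA₀, h⟩ := hτ.exists_varFun_frobeniusPerron_le hp hσ hσs hα
  have : 0 < σ := one_pos.trans hσ
  have hα₀ : 0 < α := lt_trans (by positivity) hα
  refine ⟨A₀, hA₀, fun A hA => ?_⟩
  obtain ⟨β, hβ, hvar⟩ := h A hA
  refine ⟨β, hβ, fun f => le_mul_varClass_add (ENNReal.ofReal_pos.2 hα₀).ne'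
    ENNReal.ofReal_ne_top fun g hg => ?_⟩
  rw [← eLpNorm_congr_ae hg]
  exact (varClass_le_varFun (hτ.frobeniusPerron_congr_ae hg)).trans (hvar g)

theorem exists_varClass_frobeniusPerron_le_of_pos (hτ : IsPiecewiseExpanding (1 / p) τ a s)
    (hp : 1 ≤ p) (hσ : 1 < σ) (hσs : ∀ i, σ ≤ s i) (hA : 0 < A) :
    ∃ α > 0, ∃ β > 0, ∀ f : ℝ → ℂ, varClass A p (frobeniusPerron τ a f) ≤
      ENNReal.ofReal α * varClass A p f + ENNReal.ofReal β * eLpNorm f 1 lebI := by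
  have : 0 < σ := one_pos.trans hσ
  obtain ⟨α, hα⟩ := exists_gt (σ ^ (-(1 / p)) + σ⁻¹)
  have hα₀ : 0 < α := lt_trans (by positivity) hα
  obtain ⟨A₀, hA₀, hsmall⟩ := hτ.exists_varClass_frobeniusPerron_le hp hσ hσs hα
  obtain ⟨β, hβ, hvar⟩ := hsmall (min A A₀) ⟨lt_min hA hA₀, min_le_right _ _⟩
  obtain ⟨C, hC, hCvar⟩ := exists_varClass_le (by linarith : 0 ≤ p) (lt_min hA hA₀) A
  refine ⟨C * α, by positivity, C * β, by positivity, fun f => ?_⟩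
  grw [hCvar, hvar, varClass_mono (min_le_left A A₀)]
  rw [ENNReal.ofReal_mul hC.le, ENNReal.ofReal_mul hC.le]
  exact le_of_eq (by ring)

theorem bvNorm_frobeniusPerron_le {β : ℝ} (hτ : IsPiecewiseExpanding ε τ a s) (hβ : 0 ≤ β)
    (hf : MemLp f 1 lebI)
    (h : varClass A p (frobeniusPerron τ a f) ≤
      ENNReal.ofReal α * varClass A p f + ENNReal.ofReal β * eLpNorm f 1 lebI) :
    bvNorm A p (frobeniusPerron τ a f) ≤
      ENNReal.ofReal α * bvNorm A p f + ENNReal.ofReal (β + 1) * eLpNorm f 1 lebI := by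
  calc bvNorm A p (frobeniusPerron τ a f)
      ≤ ENNReal.ofReal α * varClass A p f + ENNReal.ofReal β * eLpNorm f 1 lebI +
          eLpNorm f 1 lebI := add_le_add h (hτ.eLpNorm_frobeniusPerron_le hf)
    _ = ENNReal.ofReal α * varClass A p f + ENNReal.ofReal (β + 1) * eLpNorm f 1 lebI := by
        rw [ENNReal.ofReal_add hβ zero_le_one, ENNReal.ofReal_one]
        ring
    _ ≤ ENNReal.ofReal α * bvNorm A p f + ENNReal.ofReal (β + 1) * eLpNorm f 1 lebI := by
        gcongr
        exact le_self_add

end IsPiecewiseExpanding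

theorem theorem3p2p2 (p : ℝ) (hp : 1 ≤ p) (τ : ℝ → ℝ) (q : ℕ) (a : Fin (q + 1) → ℝ)
    (s : Fin q → ℝ) (hτ : IsPiecewiseExpanding (1 / p) τ a s)
    (σ : ℝ) (hσ : IsLeast (range s) σ) :
    -- for every choice of the constant `A` the operator is bounded in variation
    (∀ A : ℝ, 0 < A → ∃ α > (0 : ℝ), ∃ β > (0 : ℝ), ∀ f : ℝ → ℂ, MemBV A p f →
      MemBV A p (frobeniusPerron τ a f) ∧
      varClass A p (frobeniusPerron τ a f) ≤
        ENNReal.ofReal α * varClass A p f + ENNReal.ofReal β * eLpNorm f 1 lebI) ∧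
    -- for small `A` the factor may be any number above `σ^{-1/p} + σ^{-1}`
    (∀ α : ℝ, σ ^ (-(1 / p)) + σ⁻¹ < α → ∃ A₀ > (0 : ℝ), ∀ A ∈ Ioc (0 : ℝ) A₀,
      ∃ β > (0 : ℝ), ∀ f : ℝ → ℂ, MemBV A p f →
        varClass A p (frobeniusPerron τ a f) ≤
          ENNReal.ofReal α * varClass A p f + ENNReal.ofReal β * eLpNorm f 1 lebI) ∧
    -- the Lasota–Yorke inequality
    (σ ^ (-(1 / p)) + σ⁻¹ < 1 → ∃ A₀ > (0 : ℝ), ∀ A ∈ Ioc (0 : ℝ) A₀,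
      ∃ α : ℝ, 0 < α ∧ α < 1 ∧ ∃ K > (0 : ℝ), ∀ f : ℝ → ℂ, MemBV A p f →
        MemBV A p (frobeniusPerron τ a f) ∧
        bvNorm A p (frobeniusPerron τ a f) ≤
          ENNReal.ofReal α * bvNorm A p f + ENNReal.ofReal K * eLpNorm f 1 lebI) := by
  have hσ₁ : 1 < σ := by
    obtain ⟨i, rfl⟩ := hσ.1
    exact hτ.one_lt i
  have hσs (i : Fin q) : σ ≤ s i := hσ.2 (mem_range_self i)
  refine ⟨fun A hA => ?_, fun α hα => ?_, fun hlt => ?_⟩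
  · obtain ⟨α, hα, β, hβ, hvar⟩ := hτ.exists_varClass_frobeniusPerron_le_of_pos hp hσ₁ hσs hA
    exact ⟨α, hα, β, hβ, fun f hf =>
      ⟨hf.of_varClass_le (hτ.memLp_frobeniusPerron hf.1) (hvar f), hvar f⟩⟩
  · obtain ⟨A₀, hA₀, hsmall⟩ := hτ.exists_varClass_frobeniusPerron_le hp hσ₁ hσs hα
    refine ⟨A₀, hA₀, fun A hA => ?_⟩
    obtain ⟨β, hβ, hvar⟩ := hsmall A hA
    exact ⟨β, hβ, fun f _ => hvar f⟩
  · obtain ⟨α, hα, hα₁⟩ := exists_between hlt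
    have hα₀ : 0 < α := lt_trans (by positivity) hα
    obtain ⟨A₀, hA₀, hsmall⟩ := hτ.exists_varClass_frobeniusPerron_le hp hσ₁ hσs hα
    refine ⟨A₀, hA₀, fun A hA => ?_⟩
    obtain ⟨β, hβ, hvar⟩ := hsmall A hA
    exact ⟨α, hα₀, hα₁, β + 1, by positivity, fun f hf =>
      ⟨hf.of_varClass_le (hτ.memLp_frobeniusPerron hf.1) (hvar f),
        hτ.bvNorm_frobeniusPerron_le hβ.le hf.1 (hvar f)⟩⟩
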